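/- For an integer $n\ge 0$, $\beta\in\{1,2\}$ and a weight $w\ge 0$ on $\mathbb R$, let $\mathrm{ME}_{n,\beta}(w)$ be the ensemble of $n$ (unordered) real eigenvalues with joint probability density proportional to $\prod_{k=1}^n w(x_k)\prod_{1\le j<k\le n}|x_k-x_j|^\beta$, and for an integer $k$ let $E_{n,\beta}(k;J;w)$ be the probability that exactly $k$ of these eigenvalues lie in the interval $J$ (so it is $0$ if $k<0$). Let $n=2m+\mu$ with an integer $m\ge 0$ and $\mu\in\{0,1\}$, and let $(w_1,w_2)$ be one of the following pairs of weights, where $a>-1$: - Gauss: $w_1(x)=e^{-x^2/2}$, $w_2(x)=e^{-x^2}$ on $(-\infty,\infty)$; - symmetric Jacobi: $w_1(x)=(1-x^2)^a$, $w_2(x)=(1-x^2)^{2a+1}$ on $(-1,1)$, both being $0$ elsewhere; - Cauchy: $w_1(x)=(1+x^2)^{-(n+a+1)/2}$, $w_2(x)=(1+x^2)^{-(n+a)}$ on $(-\infty,\infty)$. Then the joint densities of $\mathrm{ME}_{n,1}(w_1)$ and of $\mathrm{ME}_{m,2}\big(x^{\mu-\frac12}w_2(x^{1/2})\chi_{x>0}\big)$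 are normalizable, so that these are probability distributions, and for all $k=0,1,2,\dots$ and all real $s\ge 0$ $$E_{n,1}\big(2k+\mu-1;(-s,s);w_1\big)+E_{n,1}\big(2k+\mu;(-s,s);w_1\big)=E_{m,2}\big(k;(0,s^2);x^{\mu-\frac12}w_2(x^{1/2})\chi_{x>0}\big).$$ -/

import Mathlib

open MeasureTheory

namespace GapProbability

/-- Unnormalised joint eigenvalue density `∏ₖ w(xₖ) · |Δ(x₁,…,xₙ)|^β`, where `Δ` is the
Vandermonde determinant. -/
noncomputable def unnormalizedDensity (n β : ℕ) (w : ℝ → ℝ) (x : Fin n → ℝ) : ℝ :=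
  (∏ k, w (x k)) * |(Matrix.vandermonde x).det| ^ β

/-- The measure on `ℝⁿ` whose Lebesgue density is `unnormalizedDensity n β w`. -/
noncomputable def unnormalizedLaw (n β : ℕ) (w : ℝ → ℝ) : Measure (Fin n → ℝ) :=
  volume.withDensity fun x => ENNReal.ofReal (unnormalizedDensity n β w x)

/-- Joint law of the (unordered) eigenvalues of the ensemble `ME_{n,β}(w)`; it is `OE_n(w)` for
`β = 1` and `UE_n(w)` for `β = 2`. -/
noncomputable def ensemble (n β : ℕ) (w : ℝ → ℝ) : Measure (Fin n → ℝ) :=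
  (unnormalizedLaw n β w Set.univ)⁻¹ • unnormalizedLaw n β w

/-- `E_{n,β}(k; J; w)`: the probability that exactly `k` of the `n` eigenvalues of `ME_{n,β}(w)`
lie in `J`. The index `k` is an integer, so that `E_{n,β}(-1; J; w) = 0`. -/
noncomputable def gapProb (n β : ℕ) (k : ℤ) (J : Set ℝ) (w : ℝ → ℝ) : ℝ :=
  (ensemble n β w).real {x | (({i | x i ∈ J} : Set (Fin n)).ncard : ℤ) = k}

/-- The pairs of weights `(w₁, w₂)` of the Gauss, symmetric Jacobi and Cauchy cases of order `n`.
Weights vanish off their interval of support. -/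
inductive IsWeightPair (n : ℕ) : (ℝ → ℝ) → (ℝ → ℝ) → Prop
  | gauss :
      IsWeightPair n (fun x => Real.exp (-x ^ 2 / 2)) (fun x => Real.exp (-x ^ 2))
  | jacobi (a : ℝ) (ha : -1 < a) :
      IsWeightPair n
        ((Set.Ioo (-1) 1).indicator fun x => (1 - x ^ 2) ^ a)
        ((Set.Ioo (-1) 1).indicator fun x => (1 - x ^ 2) ^ (2 * a + 1))
  | cauchy (a : ℝ) (ha : -1 < a) :
      IsWeightPair n
        (fun x => (1 + x ^ 2) ^ (-((n : ℝ) + a + 1) / 2))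
        (fun x => (1 + x ^ 2) ^ (-((n : ℝ) + a)))

/-- The weight `x^{μ - 1/2} w(x^{1/2}) χ_{x > 0}`. -/
noncomputable def squaredWeight (μ : ℕ) (w : ℝ → ℝ) : ℝ → ℝ :=
  (Set.Ioi 0).indicator fun x => x ^ ((μ : ℝ) - 1 / 2) * w (√x)

end GapProbability

open scoped ENNReal

namespace GapProbability

/-! ### Measurability and null sets -/

/-! The mechanism is decimation: of the ordered absolute values of the eigenvalues of the orthogonal
ensemble, every other one is kept, and the squares of those kept form the unitary ensemble.

Since `w₁` is even and the interval symmetric, only absolute values matter, and one may work on the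
chamber `0 < x₀ < ⋯ < xₙ₋₁`. There the sum of `|Δ(εx)|` over all signs `ε` is `2ⁿ` times the
Vandermonde determinant with the entries of odd index sum deleted
(`sum_abs_vandermonde_det_signFlip`). This determinant splits into two blocks
(`checkerboardDet_eq`): one in the retained points `y`, of indices `μ, μ+2, …`, and one in the
remaining points `z`, which interlace with `y` (`pos_strictMono_iff`).

Integrating each `z j` over its gap gives a determinant of incomplete moments of `w₁` at the `y i`
(`lintegral_gap_det`). For the classical weights `(tʳ u)'`, with `u = w₂ / w₁`, is a combination of
`tʳ⁻¹ w₁` and `tʳ⁺¹ w₁`, so column operations turn it into a constant times `∏ yᵢ^μ u(yᵢ) · Δ(y²)`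
(`exists_det_tailMoment_eq`). Together with the other block, `∏ yᵢ^μ w₁(yᵢ) · Δ(y²)`, this yields
the density `∏ yᵢ^(2μ) w₂(yᵢ) · Δ(y²)²`, which is the unitary one in the variables `y²`
(`unnormalizedLaw_squaredWeight_eq`).

Finally, exactly `k` retained points lie below `s` if and only if `2k+μ-1` or `2k+μ` of all the
points do (`ncard_decimate`). Constants cancel on normalization. -/

lemma measurableSet_ncard_eq (n : ℕ) (k : ℤ) {J : Set ℝ} (hJ : MeasurableSet J) :
    MeasurableSet {x : Fin n → ℝ | (({i | x i ∈ J} : Set (Fin n)).ncard : ℤ) = k} := by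
  have h : Measurable (fun x : Fin n → ℝ => ({i | x i ∈ J} : Set (Fin n))) := by
    rw [measurable_set_iff]
    intro i
    exact hJ.mem.comp (measurable_pi_apply i)
  have h2 : Measurable (fun s : Set (Fin n) => (s.ncard : ℤ)) := measurable_of_finite _
  exact (h2.comp h) (measurableSet_singleton k)

lemma ae_injective (n : ℕ) : ∀ᵐ x : Fin n → ℝ, Function.Injective x := by
  have h : ∀ i j : Fin n, ∀ᵐ x : Fin n → ℝ, i ≠ j → x i ≠ x j := by
    intro i j
    by_cases hij : i = j
    · simp [hij]
    -- The hyperplane `x i = x j` is a proper subspace, as it misses the `i`-th basis vector; hence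
    -- it is null.
    have h0 := Measure.addHaar_submodule (volume : Measure (Fin n → ℝ))
      (LinearMap.ker (LinearMap.proj (R := ℝ) (φ := fun _ : Fin n => ℝ) i - LinearMap.proj j)) (by
        intro h
        have h1 : Pi.single i (1 : ℝ) ∈ LinearMap.ker
            (LinearMap.proj (R := ℝ) (φ := fun _ : Fin n => ℝ) i - LinearMap.proj j) := by
          rw [h]; trivial
        have h2 : j ≠ i := fun h => hij h.symm
        simp [Pi.single_eq_of_ne h2] at h1)
    refine (measure_eq_zero_iff_ae_notMem.1 h0).mono fun x hx _ hxx => hx ?_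
    simp [hxx]
  have h' : ∀ᵐ x : Fin n → ℝ, ∀ i j : Fin n, i ≠ j → x i ≠ x j :=
    ae_all_iff.2 fun i => ae_all_iff.2 fun j => h i j
  filter_upwards [h'] with x hx i j hij
  by_contra hne
  exact hx i j hne hij

/-! ### Decomposition of integrals over fundamental domains -/

/-- If finitely many measure preserving equivalences move almost every point into `S`, each point
by at most one of them, then integrals unfold over `S`. -/
lemma lintegral_eq_sum_setLIntegral {G α : Type*} [Fintype G] [MeasurableSpace α] {ν : Measure α}
    (T : G → α ≃ᵐ α) (hT : ∀ g, MeasurePreserving (T g) ν ν) {S : Set α} (hS : MeasurableSet S)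
    (hdisj : ∀ g h x, T g x ∈ S → T h x ∈ S → g = h) (hcov : ∀ᵐ x ∂ν, ∃ g, T g x ∈ S)
    (F : α → ENNReal) :
    ∫⁻ x, F x ∂ν = ∑ g, ∫⁻ x in S, F ((T g).symm x) ∂ν := by
  have h1 : ∫⁻ x, F x ∂ν = ∫⁻ x in ⋃ g, (T g) ⁻¹' S, F x ∂ν := by
    have h2 : (⋃ g, (T g) ⁻¹' S) =ᵐ[ν] Set.univ := by
      filter_upwards [hcov] with x hx
      apply propext
      constructor
      · intro _; trivial
      · intro _
        exact Set.mem_iUnion.2 hx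
    rw [setLIntegral_congr h2, Measure.restrict_univ]
  rw [h1, lintegral_iUnion (fun g => (T g).measurable hS), tsum_fintype]
  · refine Finset.sum_congr rfl fun g _ => ?_
    have := ((hT g).restrict_preimage hS).lintegral_comp_emb (T g).measurableEmbedding
      (fun x => F ((T g).symm x))
    simpa using this
  · intro g h hgh
    refine Set.disjoint_left.2 fun x hx hx' => hgh (hdisj g h x hx hx')

/-- Coordinatewise sign change. -/
noncomputable def signFlip {n : ℕ} (ε : Fin n → ℤˣ) : (Fin n → ℝ) ≃ᵐ (Fin n → ℝ) where
  toFun x i := ((ε i : ℤ) : ℝ) * x i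
  invFun x i := ((ε i : ℤ) : ℝ) * x i
  left_inv x := by
    funext i
    rcases Int.units_eq_one_or (ε i) with h | h <;> simp [h]
  right_inv x := by
    funext i
    rcases Int.units_eq_one_or (ε i) with h | h <;> simp [h]
  measurable_toFun := by
    change Measurable fun (x : Fin n → ℝ) i => ((ε i : ℤ) : ℝ) * x i
    fun_prop
  measurable_invFun := by
    change Measurable fun (x : Fin n → ℝ) i => ((ε i : ℤ) : ℝ) * x i
    fun_prop

lemma measurePreserving_signFlip {n : ℕ} (ε : Fin n → ℤˣ) :
    MeasurePreserving (signFlip ε) volume volume := by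
  refine measurePreserving_pi (fun _ : Fin n => (volume : Measure ℝ)) (fun _ => volume)
    (f := fun i t => ((ε i : ℤ) : ℝ) * t) fun i => ?_
  rcases Int.units_eq_one_or (ε i) with h | h
  · have := MeasurePreserving.id (volume : Measure ℝ)
    simpa [h, Function.id_def] using this
  · simpa [h] using Measure.measurePreserving_neg (volume : Measure ℝ)

lemma measurableSet_pos (n : ℕ) : MeasurableSet {x : Fin n → ℝ | ∀ i, 0 < x i} := by
  simp only [Set.ofPred_forall]
  exact MeasurableSet.iInter fun i => measurableSet_lt measurable_const (measurable_pi_apply i)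

lemma measurableSet_strictMono (n : ℕ) : MeasurableSet {x : Fin n → ℝ | StrictMono x} := by
  have : {x : Fin n → ℝ | StrictMono x} = ⋂ i, ⋂ j, ⋂ _ : i < j, {x | x i < x j} := by
    ext x
    simp [StrictMono]
  rw [this]
  exact MeasurableSet.iInter fun i => MeasurableSet.iInter fun j => MeasurableSet.iInter fun _ =>
    measurableSet_lt (measurable_pi_apply i) (measurable_pi_apply j)

lemma lintegral_eq_sum_signFlip {n : ℕ} (F : (Fin n → ℝ) → ENNReal) :
    ∫⁻ x, F x = ∑ ε : Fin n → ℤˣ, ∫⁻ x in {x : Fin n → ℝ | ∀ i, 0 < x i},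
      F (fun i => ((ε i : ℤ) : ℝ) * x i) := by
  refine lintegral_eq_sum_setLIntegral signFlip measurePreserving_signFlip (measurableSet_pos n)
    ?_ ?_ F
  · intro g h x hg hh
    funext i
    have h1 : 0 < ((g i : ℤ) : ℝ) * x i := hg i
    have h2 : 0 < ((h i : ℤ) : ℝ) * x i := hh i
    rcases Int.units_eq_one_or (g i) with h3 | h3 <;>
    rcases Int.units_eq_one_or (h i) with h4 | h4 <;> simp [h3, h4] at h1 h2 ⊢ <;> linarith
  · have h : ∀ᵐ x : Fin n → ℝ, ∀ i, x i ≠ 0 :=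
      ae_all_iff.2 fun i => Measure.ae_eval_ne (fun _ => volume) i 0
    filter_upwards [h] with x hx
    refine ⟨fun i => if 0 < x i then 1 else -1, fun i => ?_⟩
    change 0 < (((if 0 < x i then 1 else -1 : ℤˣ) : ℤ) : ℝ) * x i
    split_ifs with h0
    · simpa using h0
    · have := lt_of_le_of_ne (not_lt.1 h0) (hx i)
      simpa using this

lemma lintegral_eq_sum_perm {n : ℕ} (F : (Fin n → ℝ) → ENNReal) :
    ∫⁻ x, F x = ∑ σ : Equiv.Perm (Fin n), ∫⁻ x in {x | StrictMono x}, F (x ∘ σ) := by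
  have h := lintegral_eq_sum_setLIntegral
    (fun σ : Equiv.Perm (Fin n) => MeasurableEquiv.piCongrLeft (fun _ => ℝ) σ)
    (fun σ => volume_measurePreserving_piCongrLeft (fun _ => ℝ) σ) (measurableSet_strictMono n)
    ?_ ?_ F
  · exact h
  · intro σ τ x hσ hτ
    have e : ∀ σ : Equiv.Perm (Fin n),
        (MeasurableEquiv.piCongrLeft (fun _ => ℝ) σ) x = x ∘ σ.symm := by
      intro σ
      funext i
      obtain ⟨j, rfl⟩ := σ.surjective i
      simp [MeasurableEquiv.coe_piCongrLeft, Equiv.piCongrLeft_apply]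
    rw [Set.mem_ofPred_eq, e] at hσ hτ
    have h1 := Tuple.unique_monotone hσ.monotone hτ.monotone
    have hinj : Function.Injective x := by
      have := hσ.injective.comp σ.injective
      simpa [Function.comp_assoc] using this
    have h2 : σ.symm = τ.symm := Equiv.ext fun i => hinj (congrFun h1 i)
    exact Equiv.symm_bijective.injective h2
  · filter_upwards [ae_injective n] with x hx
    refine ⟨(Tuple.sort x).symm, ?_⟩
    have e : (MeasurableEquiv.piCongrLeft (fun _ => ℝ) (Tuple.sort x).symm) x
        = x ∘ Tuple.sort x := by
      funext i
      simp [MeasurableEquiv.coe_piCongrLeft, Equiv.piCongrLeft_apply]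
    change StrictMono _
    rw [e]
    exact (Tuple.monotone_sort x).strictMono_of_injective (hx.comp (Tuple.sort x).injective)

lemma lintegral_eq_factorial_mul {n : ℕ} {F : (Fin n → ℝ) → ENNReal}
    (hF : ∀ (σ : Equiv.Perm (Fin n)) x, F (x ∘ σ) = F x) :
    ∫⁻ x, F x = n.factorial * ∫⁻ x in {x | StrictMono x}, F x := by
  rw [lintegral_eq_sum_perm F]
  simp only [hF, Finset.sum_const, Finset.card_univ, Fintype.card_perm, Fintype.card_fin,
    nsmul_eq_mul]

/-! ### Squaring the coordinates -/

lemma lintegral_pos_comp_sq {m : ℕ} (G : (Fin m → ℝ) → ENNReal) :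
    ∫⁻ x in {x : Fin m → ℝ | ∀ i, 0 < x i}, G x =
      ∫⁻ y in {y : Fin m → ℝ | ∀ i, 0 < y i}, ENNReal.ofReal (∏ i, 2 * y i) * G (fun i => y i ^ 2) := by
  have himg : (fun (y : Fin m → ℝ) i => y i ^ 2) '' {y | ∀ i, 0 < y i} = {x | ∀ i, 0 < x i} := by
    ext x
    constructor
    · rintro ⟨y, hy, rfl⟩ i
      exact pow_pos (hy i) 2
    · intro hx
      exact ⟨fun i => √(x i), fun i => Real.sqrt_pos.2 (hx i),
        funext fun i => Real.sq_sqrt (hx i).le⟩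
  have key := lintegral_image_eq_lintegral_abs_det_fderiv_mul (volume : Measure (Fin m → ℝ))
    (s := {y | ∀ i, 0 < y i}) (f := fun y i => y i ^ 2)
    (f' := fun y => ContinuousLinearMap.pi fun i => (2 * y i) • ContinuousLinearMap.proj i)
    (measurableSet_pos m) ?_ ?_ G
  · conv_lhs => rw [← himg, key]
    refine setLIntegral_congr_fun (measurableSet_pos m) fun y hy => ?_
    have hdet : (ContinuousLinearMap.pi fun i : Fin m => (2 * y i) •
        (ContinuousLinearMap.proj i : (Fin m → ℝ) →L[ℝ] ℝ)).det = ∏ i, 2 * y i := by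
      rw [ContinuousLinearMap.det, ← LinearMap.det_toMatrix', ← Matrix.det_diagonal]
      congr 1
      ext i j
      by_cases hij : i = j <;> simp [LinearMap.toMatrix'_apply, hij, Matrix.diagonal]
    have hpos : 0 ≤ ∏ i, 2 * y i := Finset.prod_nonneg fun i _ => by
      have := hy i
      positivity
    simp only [hdet, abs_of_nonneg hpos]
  · intro y _
    refine HasFDerivAt.hasFDerivWithinAt (hasFDerivAt_pi'' fun i => ?_)
    have h := ((ContinuousLinearMap.proj (R := ℝ) (φ := fun _ : Fin m => ℝ) i).hasFDerivAt
      (x := y)).pow 2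
    simpa [pow_one] using h
  · intro y hy z hz hyz
    funext i
    have h := congrFun hyz i
    exact (pow_left_inj₀ (hy i).le (hz i).le two_ne_zero).1 h

/-! ### Integrals of determinants -/

lemma integrable_det {M : ℕ} {ν : Fin M → Measure ℝ} [∀ j, SigmaFinite (ν j)]
    {φ : Fin M → ℝ → ℝ} (h : ∀ i j, Integrable (φ i) (ν j)) :
    Integrable (fun z : Fin M → ℝ => (Matrix.of fun j i => φ i (z j)).det) (Measure.pi ν) := by
  simp only [← Matrix.det_transpose (Matrix.of fun j i => φ i _), Matrix.det_apply,
    Matrix.transpose_apply, Matrix.of_apply]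
  exact integrable_finsetSum _ fun σ _ =>
    (Integrable.fintype_prod (f := fun i => φ (σ i)) fun i => h (σ i) i).smul _

/-- Row `j` involves the variable `z j` alone, so each Leibniz term is a product of one-variable
functions. Transposing makes the product run over the variables. -/
lemma integral_det {M : ℕ} {ν : Fin M → Measure ℝ} [∀ j, SigmaFinite (ν j)]
    {φ : Fin M → ℝ → ℝ} (h : ∀ i j, Integrable (φ i) (ν j)) :
    ∫ z : Fin M → ℝ, (Matrix.of fun j i => φ i (z j)).det ∂Measure.pi ν =
      (Matrix.of fun j i => ∫ t, φ i t ∂ν j).det := by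
  simp only [← Matrix.det_transpose (Matrix.of fun j i => _), Matrix.det_apply,
    Matrix.transpose_apply, Matrix.of_apply]
  rw [integral_finsetSum _ fun σ _ =>
    (Integrable.fintype_prod (f := fun i => φ (σ i)) fun i => h (σ i) i).smul _]
  refine Finset.sum_congr rfl fun σ _ => ?_
  simp only [Units.smul_def, zsmul_eq_mul]
  rw [integral_const_mul, integral_fintype_prod_eq_prod (fun i => φ (σ i))]

/-! ### Vandermonde determinants and sign changes -/

lemma vandermonde_det_pos {n : ℕ} {x : Fin n → ℝ} (hx : StrictMono x) :
    0 < (Matrix.vandermonde x).det := by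
  rw [Matrix.det_vandermonde]
  exact Finset.prod_pos fun i _ => Finset.prod_pos fun j hj =>
    sub_pos.2 (hx (Finset.mem_Ioi.1 hj))

lemma abs_vandermonde_det_comp_perm {n : ℕ} (x : Fin n → ℝ) (σ : Equiv.Perm (Fin n)) :
    |(Matrix.vandermonde (x ∘ σ)).det| = |(Matrix.vandermonde x).det| := by
  have h : Matrix.vandermonde (x ∘ σ) = (Matrix.vandermonde x).submatrix σ id := rfl
  rw [h, Matrix.det_permute, abs_mul]
  rcases Int.units_eq_one_or (Equiv.Perm.sign σ) with h | h <;> simp [h]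

/-- The determinant of the Vandermonde matrix with entries of odd index sum deleted. -/
noncomputable def checkerboardDet {n : ℕ} (x : Fin n → ℝ) : ℝ :=
  (Matrix.of fun i j : Fin n => if Even ((i : ℕ) + j) then x i ^ (j : ℕ) else 0).det

/-- For `0 < xᵢ < xⱼ` the sign of `εⱼ xⱼ - εᵢ xᵢ` is `εⱼ`, and `εⱼ` occurs once for each of the `j`
indices `i < j`. -/
lemma abs_vandermonde_det_signFlip {n : ℕ} {x : Fin n → ℝ} (h0 : ∀ i, 0 < x i)
    (hx : StrictMono x) (ε : Fin n → ℤˣ) :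
    |(Matrix.vandermonde fun i => ((ε i : ℤ) : ℝ) * x i).det| =
      (∏ i, ((ε i : ℤ) : ℝ) ^ (i : ℕ)) *
        (Matrix.vandermonde fun i => ((ε i : ℤ) : ℝ) * x i).det := by
  have hsgn : (∏ i, ((ε i : ℤ) : ℝ) ^ (i : ℕ)) = ∏ i, ∏ j ∈ Finset.Ioi i, ((ε j : ℤ) : ℝ) := by
    rw [Finset.prod_comm' (t' := Finset.univ) (s' := fun j => Finset.Iio j) (by simp)]
    simp
  rw [hsgn, Matrix.det_vandermonde, ← Finset.prod_mul_distrib, Finset.abs_prod]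
  refine Finset.prod_congr rfl fun i _ => ?_
  rw [← Finset.prod_mul_distrib, Finset.abs_prod]
  refine Finset.prod_congr rfl fun j hj => ?_
  have hij := hx (Finset.mem_Ioi.1 hj)
  have h1 := h0 i
  rcases Int.units_eq_one_or (ε i) with h | h <;> rcases Int.units_eq_one_or (ε j) with h' | h' <;>
    simp only [h, h', Units.val_one, Units.val_neg, Int.cast_one, Int.cast_neg, one_mul, neg_mul]
  · rw [abs_of_pos (by linarith)]
  · rw [abs_of_neg (by linarith)]
  · rw [abs_of_pos (by linarith)]
  · rw [abs_of_neg (by linarith)]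

/-- The sign found above can be absorbed into the rows. Row `i` then depends on `εᵢ` only, so by
multilinearity the sum is taken row by row, with entries `(1 + (-1)^(i+j)) xᵢʲ`. -/
lemma sum_abs_vandermonde_det_signFlip {n : ℕ} {x : Fin n → ℝ} (h0 : ∀ i, 0 < x i)
    (hx : StrictMono x) :
    ∑ ε : Fin n → ℤˣ, |(Matrix.vandermonde fun i => ((ε i : ℤ) : ℝ) * x i).det| =
      2 ^ n * checkerboardDet x := by
  have h := (Matrix.detRowAlternating (R := ℝ) (n := Fin n)).toMultilinearMap.map_sum
    (α := fun _ => ℤˣ)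
    (fun i e => fun j : Fin n => ((e : ℤ) : ℝ) ^ (i : ℕ) * (((e : ℤ) : ℝ) * x i) ^ (j : ℕ))
  have h1 : ∀ ε : Fin n → ℤˣ, |(Matrix.vandermonde fun i => ((ε i : ℤ) : ℝ) * x i).det| =
      (Matrix.of fun i j : Fin n =>
        ((ε i : ℤ) : ℝ) ^ (i : ℕ) * (((ε i : ℤ) : ℝ) * x i) ^ (j : ℕ)).det := by
    intro ε
    rw [abs_vandermonde_det_signFlip h0 hx, ← Matrix.det_mul_column]
    rfl
  rw [Finset.sum_congr rfl fun ε _ => h1 ε]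
  refine h.symm.trans ?_
  have h2 : 2 ^ n * checkerboardDet x = (Matrix.of fun i j : Fin n =>
      (2 : ℝ) * (if Even ((i : ℕ) + j) then x i ^ (j : ℕ) else 0)).det := by
    have := Matrix.det_mul_column (fun _ : Fin n => (2 : ℝ))
      (Matrix.of fun i j : Fin n => if Even ((i : ℕ) + j) then x i ^ (j : ℕ) else 0)
    simpa [checkerboardDet] using this.symm
  rw [h2]
  change Matrix.det _ = Matrix.det _
  congr 1
  ext i j
  rw [Finset.sum_apply, UnitsInt.univ, Finset.sum_pair (by decide)]
  simp only [Units.val_one, Units.val_neg, Int.cast_one, Int.cast_neg, Matrix.of_apply]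
  rw [one_pow, one_mul, one_mul, neg_one_mul, neg_pow (x i), ← mul_assoc, ← pow_add]
  split_ifs with hE
  · rw [hE.neg_one_pow]; ring
  · rw [(Nat.not_even_iff_odd.1 hE).neg_one_pow]; ring

/-- The lower end points of the intervals between consecutive retained points: `0` is prepended
if `μ = 1`. -/
noncomputable def lowerEnd (μ : ℕ) {m : ℕ} (y : Fin m → ℝ) (j : Fin (m + μ)) : ℝ :=
  if h : μ ≤ j then y ⟨j - μ, by omega⟩ else 0

/-- The `j`-th interval between consecutive elements of `l`, the last one being unbounded. -/
def gapInterval {M : ℕ} (l : Fin M → ℝ) (j : Fin M) : Set ℝ :=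
  {t | l j < t ∧ ∀ h : (j : ℕ) + 1 < M, t < l ⟨j + 1, h⟩}

lemma strictMono_iff_lt_next {N : ℕ} (x : Fin N → ℝ) :
    StrictMono x ↔ ∀ (i : ℕ) (h : i + 1 < N), x ⟨i, by omega⟩ < x ⟨i + 1, h⟩ := by
  constructor
  · intro hx i h
    exact hx (Fin.mk_lt_mk.2 (Nat.lt_succ_self i))
  · intro h
    cases N with
    | zero => intro i; exact i.elim0
    | succ N =>
      rw [Fin.strictMono_iff_lt_succ]
      intro i
      exact h i (by omega)

/-! ### The interlacing index equivalence -/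

/-- The indices `2i + μ`, `i < m`, interlace with the indices `2j + 1 - μ`, `j < m + μ`. -/
noncomputable def interlace {n m μ : ℕ} (hμ : μ = 0 ∨ μ = 1) (hn : n = 2 * m + μ) :
    Fin m ⊕ Fin (m + μ) ≃ Fin n :=
  Equiv.ofBijective
    (Sum.elim (fun i => ⟨2 * i + μ, by omega⟩) (fun j => ⟨2 * j + 1 - μ, by omega⟩)) (by
    rw [Fintype.bijective_iff_injective_and_card]
    constructor
    · rintro (i | i) (j | j) h <;> simp [Fin.ext_iff] at h ⊢ <;> omega
    · simp; omega)

section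
variable {n m μ : ℕ} (hμ : μ = 0 ∨ μ = 1) (hn : n = 2 * m + μ)

lemma interlace_inl (i : Fin m) : ((interlace hμ hn (Sum.inl i) : Fin n) : ℕ) = 2 * i + μ := rfl

lemma interlace_inr (j : Fin (m + μ)) :
    ((interlace hμ hn (Sum.inr j) : Fin n) : ℕ) = 2 * j + 1 - μ := rfl

/-- Grouping rows and columns by parity of the index makes the matrix block diagonal. -/
lemma checkerboardDet_eq (x : Fin n → ℝ) :
    checkerboardDet x =
      ((∏ i : Fin m, x (interlace hμ hn (Sum.inl i)) ^ μ) *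
        (Matrix.vandermonde fun i : Fin m => x (interlace hμ hn (Sum.inl i)) ^ 2).det) *
      (Matrix.of fun j i : Fin (m + μ) =>
        x (interlace hμ hn (Sum.inr j)) ^ (2 * (i : ℕ) + 1 - μ)).det := by
  rw [checkerboardDet, ← Matrix.det_submatrix_equiv_self (interlace hμ hn), ← Matrix.det_mul_column,
    ← Matrix.det_fromBlocks_zero₂₁ _ 0]
  congr 1
  ext (i | i) (j | j)
  · have : Even (2 * (i : ℕ) + μ + (2 * j + μ)) := ⟨i + j + μ, by ring⟩
    simp [interlace_inl, this, Matrix.vandermonde_apply]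
    ring
  · have : ¬ Even (2 * (i : ℕ) + μ + (2 * j + 1 - μ)) := by grind
    simp [interlace_inl, interlace_inr, this]
  · have : ¬ Even (2 * (i : ℕ) + 1 - μ + (2 * j + μ)) := by grind
    simp [interlace_inl, interlace_inr, this]
  · have : Even (2 * (i : ℕ) + 1 - μ + (2 * j + 1 - μ)) := by grind
    simp [interlace_inr, this]

lemma pos_strictMono_iff (x : Fin n → ℝ) :
    ((∀ i, 0 < x i) ∧ StrictMono x) ↔
      ((∀ i : Fin m, 0 < x (interlace hμ hn (Sum.inl i))) ∧
        StrictMono fun i : Fin m => x (interlace hμ hn (Sum.inl i))) ∧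
      ∀ j, x (interlace hμ hn (Sum.inr j)) ∈
        gapInterval (lowerEnd μ fun i : Fin m => x (interlace hμ hn (Sum.inl i))) j := by
  have hl : ∀ i (h : i < m), x (interlace hμ hn (Sum.inl ⟨i, h⟩)) = x ⟨2 * i + μ, by omega⟩ :=
    fun _ _ => rfl
  have hr : ∀ j (h : j < m + μ), x (interlace hμ hn (Sum.inr ⟨j, h⟩)) =
    x ⟨2 * j + 1 - μ, by omega⟩ := fun _ _ => rfl
  constructor
  · rintro ⟨h0, hx⟩
    refine ⟨⟨fun i => h0 _, fun i j hij => hx ?_⟩, fun j => ⟨?_, fun h => ?_⟩⟩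
    · rw [Fin.lt_def, interlace_inl, interlace_inl]
      have : (i : ℕ) < j := hij
      omega
    · rw [lowerEnd]
      split_ifs with h
      · apply hx
        rw [Fin.lt_def, interlace_inl, interlace_inr]
        simp only
        omega
      · exact h0 _
    · rw [lowerEnd, dif_pos (by simp only; omega)]
      apply hx
      rw [Fin.lt_def, interlace_inl, interlace_inr]
      simp only
      omega
  · rintro ⟨⟨h0, hy⟩, hz⟩
    have hlow : ∀ j, 0 ≤ lowerEnd μ (fun i : Fin m => x (interlace hμ hn (Sum.inl i))) j := by
      intro j
      rw [lowerEnd]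
      split_ifs
      · exact (h0 _).le
      · exact le_rfl
    constructor
    · intro i
      obtain ⟨k | k, rfl⟩ := (interlace hμ hn).surjective i
      · exact h0 k
      · exact (hlow k).trans_lt (hz k).1
    · rw [strictMono_iff_lt_next]
      intro i hi
      by_cases hpar : ∃ k, i = 2 * k + μ
      · obtain ⟨k, rfl⟩ := hpar
        have h := (hz ⟨k + μ, by omega⟩).1
        rw [lowerEnd, dif_pos (by simp), hr, hl] at h
        convert h using 3
        · simp
        · omega
      · obtain ⟨k, rfl⟩ : ∃ k, i = 2 * k + 1 - μ := by
          rcases Nat.even_or_odd' i with ⟨k, hk | hk⟩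
          · exact ⟨k, by rcases hμ with rfl | rfl <;> [exact absurd ⟨k, by omega⟩ hpar; omega]⟩
          · exact ⟨k, by rcases hμ with rfl | rfl <;> [omega; exact absurd ⟨k, by omega⟩ hpar]⟩
        have h := (hz ⟨k, by omega⟩).2 (by simp only; omega)
        rw [lowerEnd, dif_pos (by simp only; omega), hr, hl] at h
        convert h using 3
        simp only
        omega

/-! ### Counting -/

lemma fin_ncard_lt (N c : ℕ) : ({i : Fin N | (i : ℕ) < c} : Set (Fin N)).ncard = min c N := by
  rw [Set.ncard_eq_toFinset_card']
  simp [Fin.card_filter_val_lt, min_comm]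

lemma setOf_lt_eq_of_strictMono {N : ℕ} {x : Fin N → ℝ} (hx : StrictMono x) (s : ℝ) :
    {i | x i < s} = {i : Fin N | (i : ℕ) < ({i | x i < s} : Set (Fin N)).ncard} := by
  ext i
  simp only [Set.mem_ofPred_eq]
  constructor
  · intro hi
    have h : {j : Fin N | (j : ℕ) < i + 1} ⊆ {i | x i < s} := fun j hj =>
      (hx.monotone (Fin.le_def.2 (Nat.lt_succ_iff.1 hj))).trans_lt hi
    have h1 := Set.ncard_le_ncard h (Set.toFinite _)
    rw [fin_ncard_lt] at h1
    omega
  · intro hi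
    by_contra hn
    have h : {i | x i < s} ⊆ {j : Fin N | (j : ℕ) < i} := fun j hj => by
      by_contra hji
      exact hn ((hx.monotone (Fin.le_def.2 (not_lt.1 hji))).trans_lt hj)
    have h1 := Set.ncard_le_ncard h (Set.toFinite _)
    rw [fin_ncard_lt] at h1
    omega

/-- In an ordered configuration the points below `s` are the first `N`, and `2i + μ < N` amounts to
`i < (N + 1 - μ) / 2`. This quotient equals `k` exactly for the two stated values of `N`. -/
lemma ncard_decimate {x : Fin n → ℝ} (hx : StrictMono x) (s : ℝ) (k : ℕ) :
    ((({i | x i < s} : Set (Fin n)).ncard : ℤ) = 2 * (k : ℤ) + μ - 1 ∨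
      (({i | x i < s} : Set (Fin n)).ncard : ℤ) = 2 * (k : ℤ) + μ) ↔
      (({i | x (interlace hμ hn (Sum.inl i)) < s} : Set (Fin m)).ncard : ℤ) = k := by
  have h := setOf_lt_eq_of_strictMono hx s
  have hle : ({i | x i < s} : Set (Fin n)).ncard ≤ n := by
    have := Set.ncard_le_card ({i | x i < s} : Set (Fin n))
    simpa using this
  generalize ({i | x i < s} : Set (Fin n)).ncard = N at h hle
  have h2 : ({i | x (interlace hμ hn (Sum.inl i)) < s} : Set (Fin m)) =
      {i : Fin m | (i : ℕ) < (N + 1 - μ) / 2} := by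
    ext i
    have h3 : interlace hμ hn (Sum.inl i) ∈ {i | x i < s} ↔
      interlace hμ hn (Sum.inl i) ∈ {i : Fin n | (i : ℕ) < N} := by rw [h]
    simp only [Set.mem_ofPred_eq, interlace_inl] at h3 ⊢
    rw [h3]
    omega
  rw [h2, fin_ncard_lt]
  omega

/-! ### Determinants of integrals over the gaps -/

lemma det_sub_next {M : ℕ} (V : Fin M → Fin M → ℝ) :
    (Matrix.of fun j i => V j i - if h : (j : ℕ) + 1 < M then V ⟨j + 1, h⟩ i else 0).det =
      (Matrix.of V).det := by
  cases M with
  | zero => simp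
  | succ M =>
    symm
    -- Reversing the rows turns "subtract the next row" into "subtract the previous row"; the last
    -- row, left unchanged, comes first.
    rw [← Matrix.det_submatrix_equiv_self Fin.revPerm,
      ← Matrix.det_submatrix_equiv_self Fin.revPerm (Matrix.of fun j i => _ - _)]
    refine Matrix.det_eq_of_forall_row_eq_smul_add_pred (fun _ => 1) ?_ ?_
    · intro i
      simp
    · intro j i
      have h : ((Fin.rev j.succ : Fin (M + 1)) : ℕ) + 1 < M + 1 := by
        simp only [Fin.val_rev, Fin.val_succ]; omega
      have h' : (⟨(Fin.rev j.succ : Fin (M + 1)) + 1, h⟩ : Fin (M + 1)) = Fin.rev j.castSucc := by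
        ext
        simp only [Fin.val_rev, Fin.val_succ, Fin.val_castSucc]; omega
      simp only [Matrix.submatrix_apply, Matrix.of_apply, Fin.revPerm_apply, dif_pos h, h']
      ring

end

/-- The properties of a weight pair of order `n` on which the decimation argument relies. Here
`u = w₂ / w₁`, and the incomplete moments of `w₁` satisfy a two-term recurrence with
inhomogeneity `tʳ u(t)`. -/
structure IsDecimationPair (n : ℕ) (w₁ w₂ u : ℝ → ℝ) : Prop where
  measurable : Measurable w₁
  even : ∀ x, w₁ (-x) = w₁ x
  nonneg : ∀ x, 0 ≤ w₁ x
  pos : ∀ x ∈ Set.Ioo (0 : ℝ) 1, 0 < w₁ x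
  integrable : ∀ p < n, Integrable fun x => x ^ p * w₁ x
  nonneg_ratio : ∀ x, 0 < x → 0 ≤ u x
  mul_ratio : ∀ x, 0 < x → w₁ x * u x = w₂ x
  recurrence : ∀ r, r + 2 ≤ n → ∃ c d : ℝ, (r = 0 → d = 0) ∧ ∀ t, 0 ≤ t →
    ∫ x in Set.Ioi t, x ^ (r + 1) * w₁ x =
      c * (t ^ r * u t) + d * ∫ x in Set.Ioi t, x ^ (r - 1) * w₁ x

/-- Incomplete moments. -/
noncomputable def tailMoment (w : ℝ → ℝ) (p : ℕ) (t : ℝ) : ℝ := ∫ x in Set.Ioi t, x ^ p * w x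

lemma measurableSet_gapInterval {M : ℕ} (l : Fin M → ℝ) (j : Fin M) :
    MeasurableSet (gapInterval l j) := by
  have : gapInterval l j = Set.Ioi (l j) ∩ ⋂ h : (j : ℕ) + 1 < M, Set.Iio (l ⟨j + 1, h⟩) := by
    ext t
    simp [gapInterval]
  rw [this]
  exact measurableSet_Ioi.inter (MeasurableSet.iInter fun _ => measurableSet_Iio)

lemma setIntegral_gapInterval {M : ℕ} {l : Fin M → ℝ} (hl : Monotone l) {f : ℝ → ℝ}
    (hf : Integrable f) (j : Fin M) :
    ∫ t in gapInterval l j, f t = (∫ t in Set.Ioi (l j), f t) -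
      if h : (j : ℕ) + 1 < M then ∫ t in Set.Ioi (l ⟨j + 1, h⟩), f t else 0 := by
  split_ifs with h
  · have h1 : gapInterval l j = Set.Ioo (l j) (l ⟨j + 1, h⟩) := by
      ext t
      simp [gapInterval, h]
    have h2 : l j ≤ l ⟨j + 1, h⟩ := hl (Fin.le_def.2 (Nat.le_succ _))
    rw [h1, ← integral_Ioc_eq_integral_Ioo,
      ← Set.Ioc_union_Ioi_eq_Ioi h2, setIntegral_union (Set.Ioc_disjoint_Ioi le_rfl)
        measurableSet_Ioi hf.integrableOn hf.integrableOn]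
    ring
  · have h1 : gapInterval l j = Set.Ioi (l j) := by
      ext t
      simp [gapInterval, h]
    rw [h1, sub_zero]

lemma det_pow_mul_eq {μ M : ℕ} (hμ : μ = 0 ∨ μ = 1) (w : ℝ → ℝ) (z : Fin M → ℝ) :
    (Matrix.of fun j i : Fin M => z j ^ (2 * (i : ℕ) + 1 - μ) * w (z j)).det =
      (∏ j, z j ^ (1 - μ) * w (z j)) * (Matrix.vandermonde fun j => z j ^ 2).det := by
  rw [← Matrix.det_mul_column]
  congr 1
  ext j i
  have : 2 * (i : ℕ) + 1 - μ = (1 - μ) + 2 * i := by omega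
  simp only [Matrix.of_apply, Matrix.vandermonde_apply, this]
  ring

lemma lowerEnd_nonneg {μ m : ℕ} {y : Fin m → ℝ} (h0 : ∀ i, 0 < y i) (j : Fin (m + μ)) :
    0 ≤ lowerEnd μ y j := by
  rw [lowerEnd]
  split_ifs
  · exact (h0 _).le
  · exact le_rfl

lemma lowerEnd_monotone {μ m : ℕ} {y : Fin m → ℝ} (h0 : ∀ i, 0 < y i) (hy : StrictMono y) :
    Monotone (lowerEnd μ y) := by
  intro i j hij
  have hij' : (i : ℕ) ≤ j := hij
  rw [lowerEnd, lowerEnd]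
  split_ifs with h1 h2
  · exact hy.monotone (Fin.le_def.2 (by simp only; omega))
  · omega
  · exact (h0 _).le
  · exact le_rfl

lemma strictMono_of_mem_gapInterval {M : ℕ} {l z : Fin M → ℝ}
    (hz : ∀ j, z j ∈ gapInterval l j) : StrictMono z := by
  rw [strictMono_iff_lt_next]
  intro i h
  exact ((hz _).2 h).trans (hz _).1

lemma strictMono_sq {M : ℕ} {z : Fin M → ℝ} (h0 : ∀ i, 0 < z i) (hz : StrictMono z) :
    StrictMono fun j => z j ^ 2 :=
  fun i _ hij => pow_lt_pow_left₀ (hz hij) (h0 i).le two_ne_zero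

section
variable {n m μ : ℕ} (hμ : μ = 0 ∨ μ = 1) (hn : n = 2 * m + μ) {w₁ w₂ u : ℝ → ℝ}
  (hw : IsDecimationPair n w₁ w₂ u)
include hμ hn hw

/-- Integration row by row gives differences of tail integrals at consecutive end points, and row
operations telescope them. -/
lemma lintegral_gap_det {y : Fin m → ℝ} (h0 : ∀ i, 0 < y i) (hy : StrictMono y) :
    ∫⁻ z in {z : Fin (m + μ) → ℝ | ∀ j, z j ∈ gapInterval (lowerEnd μ y) j},
      ENNReal.ofReal
        (Matrix.of fun j i : Fin (m + μ) => z j ^ (2 * (i : ℕ) + 1 - μ) * w₁ (z j)).det =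
    ENNReal.ofReal
      (Matrix.of fun j i : Fin (m + μ) => tailMoment w₁ (2 * i + 1 - μ) (lowerEnd μ y j)).det := by
  have hset : {z : Fin (m + μ) → ℝ | ∀ j, z j ∈ gapInterval (lowerEnd μ y) j} =
      Set.univ.pi fun j => gapInterval (lowerEnd μ y) j := by
    ext z; simp
  have hint : ∀ i : Fin (m + μ), Integrable fun t : ℝ => t ^ (2 * (i : ℕ) + 1 - μ) * w₁ t :=
    fun i => hw.integrable _ (by omega)
  have hres : (volume : Measure (Fin (m + μ) → ℝ)).restrict
      (Set.univ.pi fun j => gapInterval (lowerEnd μ y) j) =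
      Measure.pi fun j => (volume : Measure ℝ).restrict (gapInterval (lowerEnd μ y) j) :=
    Measure.restrict_pi_pi _ _
  have hmeas : MeasurableSet (Set.univ.pi fun j => gapInterval (lowerEnd μ y) j) :=
    MeasurableSet.univ_pi fun j => measurableSet_gapInterval _ j
  have hI := integrable_det (ν := fun j => volume.restrict (gapInterval (lowerEnd μ y) j))
    (φ := fun (i : Fin (m + μ)) t => t ^ (2 * (i : ℕ) + 1 - μ) * w₁ t)
    fun i j => (hint i).integrableOn
  rw [hset, ← ofReal_integral_eq_lintegral_ofReal]
  · rw [hres, integral_det (φ := fun (i : Fin (m + μ)) t => t ^ (2 * (i : ℕ) + 1 - μ) * w₁ t)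
      fun i j => (hint i).integrableOn,
      ← det_sub_next fun j i => tailMoment w₁ (2 * (i : ℕ) + 1 - μ) (lowerEnd μ y j)]
    congr 3
    ext j i
    exact setIntegral_gapInterval (lowerEnd_monotone h0 hy) (hint i) j
  · rw [hres]
    exact hI
  -- Points in successive gaps are increasing and positive, so the determinant is nonnegative and
  -- `ENNReal.ofReal` loses nothing.
  · refine (ae_restrict_mem hmeas).mono fun z hz => ?_
    have hz' : ∀ j, z j ∈ gapInterval (lowerEnd μ y) j := fun j => hz j trivial
    have hz0 : ∀ j, 0 < z j := fun j => (lowerEnd_nonneg h0 j).trans_lt (hz' j).1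
    simp only [Pi.zero_apply]
    rw [det_pow_mul_eq hμ]
    refine mul_nonneg (Finset.prod_nonneg fun j _ => mul_nonneg (pow_nonneg (hz0 j).le _)
      (hw.nonneg _)) (vandermonde_det_pos (strictMono_sq hz0 (strictMono_of_mem_gapInterval hz'))).le

/-- The recurrence writes each column as its inhomogeneity plus a multiple of the preceding column,
which does not change the determinant. -/
lemma exists_det_tailMoment_eq :
    ∃ C : ℝ, ∀ y : Fin m → ℝ, (∀ i, 0 < y i) →
      (Matrix.of fun j i : Fin (m + μ) => tailMoment w₁ (2 * i + 1 - μ) (lowerEnd μ y j)).det =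
        C * ((∏ i, y i ^ μ * u (y i)) * (Matrix.vandermonde fun i => y i ^ 2).det) := by
  choose! c d hd hrec using hw.recurrence
  have hrec' : ∀ r, r + 2 ≤ n → ∀ t, 0 ≤ t →
      tailMoment w₁ (r + 1) t = c r * (t ^ r * u t) + d r * tailMoment w₁ (r - 1) t := hrec
  rcases hμ with rfl | rfl
  · have hl : ∀ (y : Fin m → ℝ) (j : Fin (m + 0)), lowerEnd 0 y j = y j := fun y j => by
      simp [lowerEnd]
    refine ⟨∏ i : Fin m, c (2 * i), fun y h0 => ?_⟩
    cases m with
    | zero => simp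
    | succ k =>
      have hA := Matrix.det_eq_of_forall_col_eq_smul_add_pred (n := k)
        (A := Matrix.of fun j i : Fin (k + 1) => tailMoment w₁ (2 * i + 1) (y j))
        (B := Matrix.of fun j i : Fin (k + 1) => c (2 * i) * (u (y j) * (y j ^ 2) ^ (i : ℕ)))
        (fun i => d (2 * (i + 1))) ?_ ?_
      · simp only [hl]
        refine hA.trans ?_
        have h1 := Matrix.det_mul_row (fun i : Fin (k + 1) => c (2 * i))
          (Matrix.of fun j i : Fin (k + 1) => u (y j) * (y j ^ 2) ^ (i : ℕ))
        have h2 := Matrix.det_mul_column (fun j : Fin (k + 1) => u (y j))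
          (Matrix.vandermonde fun j => y j ^ 2)
        simp only [pow_zero, one_mul]
        rw [← h2]
        exact h1
      -- The first column is the case `r = 0`: it has no predecessor, whence the requirement `d = 0`
      -- there.
      · intro i
        have := hrec' 0 (by omega) (y i) (h0 i).le
        simp [this, hd 0 (by omega) rfl]
      · intro i j
        have hj := j.2
        have := hrec' (2 * (j + 1)) (by omega) (y i) (h0 i).le
        have e : 2 * ((j : ℕ) + 1) - 1 = 2 * j + 1 := by omega
        rw [e] at this
        simp only [Matrix.of_apply, Fin.val_succ, Fin.val_castSucc]
        rw [this, ← pow_mul]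
        ring
  · have hl0 : ∀ (y : Fin m → ℝ), lowerEnd 1 y 0 = 0 := fun y => by simp [lowerEnd]
    have hls : ∀ (y : Fin m → ℝ) (j : Fin m), lowerEnd 1 y j.succ = y j := fun y j => by
      simp [lowerEnd]
    refine ⟨tailMoment w₁ 0 0 * ∏ i : Fin m, c (2 * i + 1), fun y h0 => ?_⟩
    have hA := Matrix.det_eq_of_forall_col_eq_smul_add_pred (n := m)
        (A := Matrix.of fun j i : Fin (m + 1) => tailMoment w₁ (2 * i) (lowerEnd 1 y j))
        (B := Matrix.of fun j i : Fin (m + 1) => Fin.cases (tailMoment w₁ 0 (lowerEnd 1 y j))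
          (fun i : Fin m => c (2 * i + 1) *
            (lowerEnd 1 y j ^ (2 * (i : ℕ) + 1) * u (lowerEnd 1 y j))) i)
        (fun i => d (2 * i + 1)) ?_ ?_
    · refine hA.trans ?_
      -- The first end point is `0`, where `t^(2i+1) u(t)` vanishes. Only the corner entry of row
      -- `0` survives, and it is absorbed into the constant.
      rw [Matrix.det_succ_row_zero, Fin.sum_univ_succ, Finset.sum_eq_zero]
      · simp only [Fin.val_zero, pow_zero, one_mul, add_zero, Matrix.of_apply, Fin.cases_zero, hl0,
          mul_assoc]
        congr 1
        have h1 := Matrix.det_mul_row (fun i : Fin m => c (2 * i + 1))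
          (Matrix.of fun j i : Fin m => (y j ^ 1 * u (y j)) * (y j ^ 2) ^ (i : ℕ))
        have h2 := Matrix.det_mul_column (fun j : Fin m => y j ^ 1 * u (y j))
          (Matrix.vandermonde fun j => y j ^ 2)
        rw [← h2]
        refine Eq.trans ?_ h1
        congr 1
        ext j i
        simp only [Matrix.submatrix_apply, Matrix.of_apply, Fin.succAbove_zero, Fin.cases_succ, hls]
        ring
      · intro i _
        simp [hl0]
    · intro i
      simp
    · intro i j
      have hj := j.2
      have := hrec' (2 * j + 1) (by omega) (lowerEnd 1 y i) (lowerEnd_nonneg h0 i)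
      simp only [Matrix.of_apply, Fin.val_succ, Fin.val_castSucc, Fin.cases_succ]
      simpa [Nat.mul_add, Nat.add_assoc] using this

end

/-! ### Reduction to the ordered chamber -/

/-- The open chamber `0 < x₁ < ⋯ < xₙ`. -/
def chamber (n : ℕ) : Set (Fin n → ℝ) := {x | (∀ i, 0 < x i) ∧ StrictMono x}

lemma measurableSet_chamber (n : ℕ) : MeasurableSet (chamber n) :=
  (measurableSet_pos n).inter (measurableSet_strictMono n)

lemma measurable_vandermonde_det (n : ℕ) :
    Measurable fun x : Fin n → ℝ => (Matrix.vandermonde x).det := by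
  simp only [Matrix.det_vandermonde]
  fun_prop

lemma measurable_unnormalizedDensity (n β : ℕ) {w : ℝ → ℝ} (hw : Measurable w) :
    Measurable (unnormalizedDensity n β w) := by
  unfold unnormalizedDensity
  exact (by fun_prop : Measurable fun x : Fin n → ℝ => ∏ k, w (x k)).mul
    ((measurable_vandermonde_det n).norm.pow_const β)

lemma unnormalizedDensity_comp_perm (n β : ℕ) (w : ℝ → ℝ) (σ : Equiv.Perm (Fin n))
    (x : Fin n → ℝ) : unnormalizedDensity n β w (x ∘ σ) = unnormalizedDensity n β w x := by
  rw [unnormalizedDensity, abs_vandermonde_det_comp_perm]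
  simp only [Function.comp_apply]
  rw [Equiv.prod_comp σ fun i => w (x i), unnormalizedDensity]

lemma unnormalizedLaw_apply {n β : ℕ} {w : ℝ → ℝ} {A : Set (Fin n → ℝ)} (hA : MeasurableSet A) :
    unnormalizedLaw n β w A =
      ∫⁻ x, A.indicator (fun x => ENNReal.ofReal (unnormalizedDensity n β w x)) x := by
  rw [unnormalizedLaw, withDensity_apply _ hA, lintegral_indicator hA]

/-- Sign changes fold the integral onto the positive orthant. The summed integrand is still
symmetric, so ordering the points contributes `n!`. -/
lemma unnormalizedLaw_one_eq {n : ℕ} {w : ℝ → ℝ} (hw : Measurable w) (hw0 : ∀ x, 0 ≤ w x)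
    (heven : ∀ x, w (-x) = w x) {A : Set (Fin n → ℝ)} (hA : MeasurableSet A)
    (hperm : ∀ (σ : Equiv.Perm (Fin n)) x, x ∘ σ ∈ A ↔ x ∈ A)
    (hsign : ∀ (ε : Fin n → ℤˣ) x, (fun i => ((ε i : ℤ) : ℝ) * x i) ∈ A ↔ x ∈ A) :
    unnormalizedLaw n 1 w A = n.factorial * ∫⁻ x in chamber n,
      A.indicator (fun x => ENNReal.ofReal ((∏ k, w (x k)) * (2 ^ n * checkerboardDet x))) x := by
  have hF : Measurable
      (A.indicator (fun x => ENNReal.ofReal (unnormalizedDensity n 1 w x))) :=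
    (measurable_unnormalizedDensity n 1 hw).ennreal_ofReal.indicator hA
  have hw' : ∀ (e : ℤˣ) x, w (((e : ℤ) : ℝ) * x) = w x := by
    intro e x
    rcases Int.units_eq_one_or e with rfl | rfl <;> simp [heven]
  set S : (Fin n → ℝ) → ℝ := fun x =>
    ∑ ε : Fin n → ℤˣ, |(Matrix.vandermonde fun i => ((ε i : ℤ) : ℝ) * x i).det| with hS
  have hSperm : ∀ (σ : Equiv.Perm (Fin n)) x, S (x ∘ σ) = S x := by
    intro σ x
    -- Permuting the points is compensated by permuting the signs.
    refine Fintype.sum_equiv (Equiv.arrowCongr σ (Equiv.refl ℤˣ)) _ _ fun ε => ?_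
    refine Eq.trans ?_ (abs_vandermonde_det_comp_perm _ σ)
    congr 3
    funext i
    simp [Equiv.arrowCongr]
  have h1 : ∀ (ε : Fin n → ℤˣ) x,
      A.indicator (fun x => ENNReal.ofReal (unnormalizedDensity n 1 w x))
        (fun i => ((ε i : ℤ) : ℝ) * x i) =
      A.indicator (fun x => ENNReal.ofReal ((∏ k, w (x k)) *
        |(Matrix.vandermonde fun i => ((ε i : ℤ) : ℝ) * x i).det|)) x := by
    intro ε x
    by_cases hx : x ∈ A
    · rw [Set.indicator_of_mem hx, Set.indicator_of_mem ((hsign ε x).2 hx)]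
      simp only [unnormalizedDensity, hw', pow_one]
    · rw [Set.indicator_of_notMem hx, Set.indicator_of_notMem (mt (hsign ε x).1 hx)]
  have h2 : ∀ x, ∑ ε : Fin n → ℤˣ, A.indicator (fun x => ENNReal.ofReal ((∏ k, w (x k)) *
        |(Matrix.vandermonde fun i => ((ε i : ℤ) : ℝ) * x i).det|)) x =
      A.indicator (fun x => ENNReal.ofReal ((∏ k, w (x k)) * S x)) x := by
    intro x
    by_cases hx : x ∈ A
    · simp only [Set.indicator_of_mem hx, hS]
      rw [Finset.mul_sum, ENNReal.ofReal_sum_of_nonneg]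
      intro ε _
      exact mul_nonneg (Finset.prod_nonneg fun _ _ => hw0 _) (abs_nonneg _)
    · simp [Set.indicator_of_notMem hx]
  rw [unnormalizedLaw_apply hA, lintegral_eq_sum_signFlip, ← lintegral_finsetSum]
  · simp only [h1, h2]
    rw [← lintegral_indicator (measurableSet_pos n), lintegral_eq_factorial_mul,
      setLIntegral_indicator (measurableSet_pos n)]
    · congr 1
      refine setLIntegral_congr_fun (measurableSet_chamber n) fun x hx => ?_
      simp only [hS]
      by_cases hxA : x ∈ A
      · rw [Set.indicator_of_mem hxA, Set.indicator_of_mem hxA,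
          sum_abs_vandermonde_det_signFlip hx.1 hx.2]
      · rw [Set.indicator_of_notMem hxA, Set.indicator_of_notMem hxA]
    · intro σ x
      classical
      have hp : (∀ i, 0 < x (σ i)) ↔ ∀ i, 0 < x i :=
        (σ.surjective.forall (p := fun i => 0 < x i)).symm
      simp only [Set.indicator_apply, Set.mem_ofPred_eq, hp, hperm, hSperm, Function.comp_apply,
        Equiv.prod_comp σ fun i => w (x i)]
  · intro ε _
    exact hF.comp (signFlip ε).measurable

/-! ### Integrating out every other point -/

/-- Restricting a configuration to the retained and to the integrated points. -/
noncomputable def splitEquiv {n m μ : ℕ} (hμ : μ = 0 ∨ μ = 1) (hn : n = 2 * m + μ) :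
    ((Fin m → ℝ) × (Fin (m + μ) → ℝ)) ≃ᵐ (Fin n → ℝ) :=
  (MeasurableEquiv.sumPiEquivProdPi fun _ : Fin m ⊕ Fin (m + μ) => ℝ).symm.trans
    (MeasurableEquiv.piCongrLeft (fun _ : Fin n => ℝ) (interlace hμ hn))

/-- The density of the squares of the retained points, in terms of the retained points. -/
noncomputable def decimatedDensity (m μ : ℕ) (w₂ : ℝ → ℝ) (y : Fin m → ℝ) : ℝ :=
  (∏ i, y i ^ (2 * μ) * w₂ (y i)) * (Matrix.vandermonde fun i => y i ^ 2).det ^ 2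

/-- The weight of a set of squares of retained points. -/
noncomputable def decimatedMass (m μ : ℕ) (w₂ : ℝ → ℝ) (B : Set (Fin m → ℝ)) : ℝ≥0∞ :=
  ∫⁻ y in chamber m, ((fun y i => y i ^ 2) ⁻¹' B).indicator
    (fun y => ENNReal.ofReal (decimatedDensity m μ w₂ y)) y

section
variable {n m μ : ℕ} (hμ : μ = 0 ∨ μ = 1) (hn : n = 2 * m + μ) {w₁ w₂ u : ℝ → ℝ}

lemma measurePreserving_splitEquiv : MeasurePreserving (splitEquiv hμ hn) volume volume :=
  (volume_measurePreserving_piCongrLeft (fun _ : Fin n => ℝ) (interlace hμ hn)).comp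
    (volume_measurePreserving_sumPiEquivProdPi fun _ : Fin m ⊕ Fin (m + μ) => ℝ).symm

lemma splitEquiv_inl (y : Fin m → ℝ) (z : Fin (m + μ) → ℝ) (i : Fin m) :
    splitEquiv hμ hn (y, z) (interlace hμ hn (Sum.inl i)) = y i := by
  change Equiv.piCongrLeft (fun _ : Fin n => ℝ) (interlace hμ hn) _ _ = _
  rw [Equiv.piCongrLeft_apply_apply]
  rfl

lemma splitEquiv_inr (y : Fin m → ℝ) (z : Fin (m + μ) → ℝ) (j : Fin (m + μ)) :
    splitEquiv hμ hn (y, z) (interlace hμ hn (Sum.inr j)) = z j := by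
  change Equiv.piCongrLeft (fun _ : Fin n => ℝ) (interlace hμ hn) _ _ = _
  rw [Equiv.piCongrLeft_apply_apply]
  rfl

-- The constant does not depend on the event, so it cancels against the one obtained for the whole
-- space. Its positivity is not needed here.
include hμ hn in
lemma exists_unnormalizedLaw_one_eq (hw : IsDecimationPair n w₁ w₂ u) :
    ∃ c : ℝ≥0∞, c ≠ ⊤ ∧ ∀ (A : Set (Fin n → ℝ)) (B : Set (Fin m → ℝ)), MeasurableSet A →
      (∀ (σ : Equiv.Perm (Fin n)) x, x ∘ σ ∈ A ↔ x ∈ A) →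
      (∀ (ε : Fin n → ℤˣ) x, (fun i => ((ε i : ℤ) : ℝ) * x i) ∈ A ↔ x ∈ A) →
      (∀ x ∈ chamber n, x ∈ A ↔ (fun i => x (interlace hμ hn (Sum.inl i)) ^ 2) ∈ B) →
      unnormalizedLaw n 1 w₁ A = c * decimatedMass m μ w₂ B := by
  obtain ⟨C, hC⟩ := exists_det_tailMoment_eq hμ hn hw
  refine ⟨n.factorial * ENNReal.ofReal (2 ^ n * C),
    ENNReal.mul_ne_top (by simp) ENNReal.ofReal_ne_top, ?_⟩
  intro A B hA hperm hsign hAB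
  rw [unnormalizedLaw_one_eq hw.measurable hw.nonneg hw.even hA hperm hsign, mul_assoc]
  congr 1
  have hcheck : Measurable fun x : Fin n → ℝ => checkerboardDet x := by
    simp only [checkerboardDet_eq hμ hn, Matrix.det_apply, Matrix.vandermonde_apply,
      Matrix.of_apply]
    fun_prop
  have hF : Measurable (A.indicator (fun x : Fin n → ℝ =>
      ENNReal.ofReal ((∏ k, w₁ (x k)) * (2 ^ n * checkerboardDet x)))) := by
    refine Measurable.indicator (Measurable.ennreal_ofReal ?_) hA
    have := hw.measurable
    fun_prop
  have hG := hF.indicator (measurableSet_chamber n)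
  rw [← lintegral_indicator (measurableSet_chamber n),
    ← (measurePreserving_splitEquiv hμ hn).lintegral_comp hG, Measure.volume_eq_prod,
    lintegral_prod _ (hG.fun_comp (splitEquiv hμ hn).measurable).aemeasurable, decimatedMass,
    ← lintegral_const_mul' _ _ ENNReal.ofReal_ne_top,
    ← lintegral_indicator (measurableSet_chamber m)]
  refine lintegral_congr fun y => ?_
  have hch : ∀ z, splitEquiv hμ hn (y, z) ∈ chamber n ↔
      y ∈ chamber m ∧ z ∈ {z | ∀ j, z j ∈ gapInterval (lowerEnd μ y) j} := by
    intro z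
    have := pos_strictMono_iff hμ hn (splitEquiv hμ hn (y, z))
    simp only [splitEquiv_inl, splitEquiv_inr] at this
    exact this
  by_cases hy : y ∈ chamber m
  · rw [Set.indicator_of_mem hy]
    -- The part of the density depending only on the retained points; it leaves the inner integral.
    set D : ℝ := 2 ^ n * ((∏ i, w₁ (y i)) *
      ((∏ i, y i ^ μ) * (Matrix.vandermonde fun i => y i ^ 2).det)) with hD
    have hV := (vandermonde_det_pos (strictMono_sq hy.1 hy.2)).le
    have hD0 : 0 ≤ D := mul_nonneg (by positivity) (mul_nonneg
      (Finset.prod_nonneg fun i _ => hw.nonneg _)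
      (mul_nonneg (Finset.prod_nonneg fun i _ => pow_nonneg (hy.1 i).le _) hV))
    have hpt : ∀ z, (chamber n).indicator (A.indicator (fun x : Fin n → ℝ =>
        ENNReal.ofReal ((∏ k, w₁ (x k)) * (2 ^ n * checkerboardDet x))))
        (splitEquiv hμ hn (y, z)) =
      (((fun y i => y i ^ 2) ⁻¹' B).indicator (fun _ => ENNReal.ofReal D) y) *
        {z | ∀ j, z j ∈ gapInterval (lowerEnd μ y) j}.indicator (fun z => ENNReal.ofReal
        (Matrix.of fun j i : Fin (m + μ) => z j ^ (2 * (i : ℕ) + 1 - μ) * w₁ (z j)).det) z := by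
      intro z
      by_cases hz : z ∈ {z | ∀ j, z j ∈ gapInterval (lowerEnd μ y) j}
      · have hx := (hch z).2 ⟨hy, hz⟩
        have hxA := hAB _ hx
        simp only [splitEquiv_inl] at hxA
        rw [Set.indicator_of_mem hz, Set.indicator_of_mem hx]
        by_cases hB : y ∈ (fun (y : Fin m → ℝ) i => y i ^ 2) ⁻¹' B
        · rw [Set.indicator_of_mem (hxA.2 hB), Set.indicator_of_mem hB,
            ← ENNReal.ofReal_mul hD0]
          congr 1
          have hdet := Matrix.det_mul_column (fun j => w₁ (z j))
            (Matrix.of fun j i : Fin (m + μ) => z j ^ (2 * (i : ℕ) + 1 - μ))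
          simp only [Matrix.of_apply, mul_comm (w₁ _)] at hdet
          rw [hdet, checkerboardDet_eq hμ hn, ← Equiv.prod_comp (interlace hμ hn),
            Fintype.prod_sum_type]
          simp only [splitEquiv_inl, splitEquiv_inr]
          rw [hD]
          ring
        · rw [Set.indicator_of_notMem (mt hxA.1 hB), Set.indicator_of_notMem hB, zero_mul]
      · rw [Set.indicator_of_notMem hz, mul_zero,
          Set.indicator_of_notMem fun h => hz ((hch z).1 h).2]
    simp only [hpt]
    have hmeas : MeasurableSet {z : Fin (m + μ) → ℝ | ∀ j, z j ∈ gapInterval (lowerEnd μ y) j} := by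
      simp only [Set.ofPred_forall]
      exact MeasurableSet.iInter fun j =>
        (measurableSet_gapInterval _ j).preimage (measurable_pi_apply j)
    rw [lintegral_const_mul', lintegral_indicator hmeas, lintegral_gap_det hμ hn hw hy.1 hy.2,
      hC y hy.1]
    · by_cases hB : y ∈ (fun (y : Fin m → ℝ) i => y i ^ 2) ⁻¹' B
      · rw [Set.indicator_of_mem hB, Set.indicator_of_mem hB, ← ENNReal.ofReal_mul hD0,
          ← ENNReal.ofReal_mul']
        · congr 1
          have : ∏ i, y i ^ (2 * μ) * w₂ (y i) =
              (∏ i, w₁ (y i)) * ((∏ i, y i ^ μ) * ∏ i, y i ^ μ * u (y i)) := by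
            rw [← Finset.prod_mul_distrib, ← Finset.prod_mul_distrib]
            refine Finset.prod_congr rfl fun i _ => ?_
            rw [← hw.mul_ratio _ (hy.1 i)]
            ring
          rw [decimatedDensity, this, hD]
          ring
        · rw [decimatedDensity]
          refine mul_nonneg (Finset.prod_nonneg fun i _ => mul_nonneg (pow_nonneg (hy.1 i).le _) ?_)
            (sq_nonneg _)
          rw [← hw.mul_ratio _ (hy.1 i)]
          exact mul_nonneg (hw.nonneg _) (hw.nonneg_ratio _ (hy.1 i))
      · simp [Set.indicator_of_notMem hB]
    · by_cases hB : y ∈ (fun (y : Fin m → ℝ) i => y i ^ 2) ⁻¹' B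
      · rw [Set.indicator_of_mem hB]; exact ENNReal.ofReal_ne_top
      · rw [Set.indicator_of_notMem hB]; exact ENNReal.zero_ne_top
  · rw [Set.indicator_of_notMem hy]
    have : ∀ z, (chamber n).indicator (A.indicator (fun x : Fin n → ℝ =>
        ENNReal.ofReal ((∏ k, w₁ (x k)) * (2 ^ n * checkerboardDet x))))
        (splitEquiv hμ hn (y, z)) = 0 := fun z =>
      Set.indicator_of_notMem (fun h => hy ((hch z).1 h).1) _
    simp [this]

end

/-! ### The squared ensemble -/

lemma unnormalizedLaw_squaredWeight_eq {m μ : ℕ} (w₂ : ℝ → ℝ) {B : Set (Fin m → ℝ)}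
    (hB : MeasurableSet B) (hperm : ∀ (σ : Equiv.Perm (Fin m)) x, x ∘ σ ∈ B ↔ x ∈ B) :
    unnormalizedLaw m 2 (squaredWeight μ w₂) B =
      (m.factorial * 2 ^ m) * decimatedMass m μ w₂ B := by
  set f : (Fin m → ℝ) → ℝ≥0∞ := B.indicator (fun x =>
    ENNReal.ofReal (unnormalizedDensity m 2 (squaredWeight μ w₂) x)) with hf
  have hzero : ∀ x, ¬ (∀ i, 0 < x i) → f x = 0 := by
    intro x hx
    push Not at hx
    obtain ⟨i, hi⟩ := hx
    have : unnormalizedDensity m 2 (squaredWeight μ w₂) x = 0 := by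
      rw [unnormalizedDensity, Finset.prod_eq_zero (Finset.mem_univ i), zero_mul]
      exact Set.indicator_of_notMem (not_lt.2 hi) _
    simp [hf, this]
  rw [unnormalizedLaw_apply hB, lintegral_eq_factorial_mul, mul_assoc]
  · congr 1
    have h1 : ∫⁻ x in {x | StrictMono x}, f x = ∫⁻ x in {x : Fin m → ℝ | ∀ i, 0 < x i},
        {x | StrictMono x}.indicator f x := by
      rw [setLIntegral_indicator (measurableSet_strictMono m), Set.inter_comm,
        ← setLIntegral_indicator (measurableSet_pos m)]
      refine lintegral_congr fun x => ?_
      by_cases hx : x ∈ {x : Fin m → ℝ | ∀ i, 0 < x i}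
      · rw [Set.indicator_of_mem hx]
      · rw [Set.indicator_of_notMem hx, hzero x hx]
    have hch : {y : Fin m → ℝ | StrictMono y} ∩ {y | ∀ i, 0 < y i} = chamber m :=
      Set.inter_comm _ _
    rw [h1, lintegral_pos_comp_sq, decimatedMass,
      ← lintegral_const_mul' _ _ (ENNReal.pow_ne_top (by simp)), ← hch,
      ← setLIntegral_indicator (measurableSet_strictMono m)]
    refine setLIntegral_congr_fun (measurableSet_pos m) fun y hy => ?_
    have hmono : (fun i => y i ^ 2) ∈ {x : Fin m → ℝ | StrictMono x} ↔
        y ∈ {x : Fin m → ℝ | StrictMono x} := by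
      constructor
      · intro h i j hij
        exact (pow_lt_pow_iff_left₀ (hy i).le (hy j).le two_ne_zero).1 (h hij)
      · intro h
        exact strictMono_sq hy h
    by_cases hys : y ∈ {x : Fin m → ℝ | StrictMono x}
    · simp only [Set.indicator_of_mem hys, Set.indicator_of_mem (hmono.2 hys)]
      by_cases hyB : (fun i => y i ^ 2) ∈ B
      · rw [hf, Set.indicator_of_mem hyB, Set.indicator_of_mem (show y ∈ (fun (y : Fin m → ℝ) i => y i ^ 2) ⁻¹' B from hyB),
          ← ENNReal.ofReal_mul (Finset.prod_nonneg fun i _ => by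
            have := hy i
            positivity)]
        have h2 : (2 : ℝ≥0∞) ^ m = ENNReal.ofReal (2 ^ m) := by
          rw [ENNReal.ofReal_pow two_pos.le, ENNReal.ofReal_ofNat]
        rw [h2, ← ENNReal.ofReal_mul (by positivity)]
        congr 1
        rw [unnormalizedDensity, decimatedDensity, sq_abs, ← mul_assoc, ← mul_assoc,
          ← Finset.prod_mul_distrib]
        congr 1
        have h3 : (2 : ℝ) ^ m = ∏ _i : Fin m, 2 := by simp
        rw [h3, ← Finset.prod_mul_distrib]
        refine Finset.prod_congr rfl fun i _ => ?_
        have hyi := hy i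
        have hmem : y i ^ 2 ∈ Set.Ioi (0 : ℝ) := Set.mem_Ioi.2 (by positivity)
        rw [squaredWeight, Set.indicator_of_mem hmem, Real.sqrt_sq hyi.le]
        -- The Jacobian factor `y i` accounts for the `-1/2` in the exponent of the squared weight.
        have h4 : (y i ^ 2) ^ ((μ : ℝ) - 1 / 2) * y i = y i ^ (2 * μ) := by
          rw [← Real.rpow_natCast (y i) 2, ← Real.rpow_mul hyi.le, ← Real.rpow_natCast (y i),
            ← Real.rpow_add_one hyi.ne']
          congr 1
          push_cast
          ring
        rw [← h4]
        ring
      · rw [hf, Set.indicator_of_notMem hyB, Set.indicator_of_notMem (show y ∉ (fun (y : Fin m → ℝ) i => y i ^ 2) ⁻¹' B from hyB),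
          mul_zero, mul_zero]
    · rw [Set.indicator_of_notMem hys, Set.indicator_of_notMem (mt hmono.1 hys), mul_zero]
  · intro σ x
    classical
    simp only [Set.indicator_apply, hperm, unnormalizedDensity_comp_perm]

/-! ### Normalizability -/

/-- For `β = 1` the density is the absolute value of the determinant with entries `xⱼⁱ w(xⱼ)`, whose
Leibniz terms are integrable. -/
lemma unnormalizedLaw_one_univ_ne_top {n : ℕ} {w : ℝ → ℝ}
    (hint : ∀ p < n, Integrable fun x => x ^ p * w x) (hw0 : ∀ x, 0 ≤ w x) :
    unnormalizedLaw n 1 w Set.univ ≠ ⊤ := by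
  have h := integrable_det (ν := fun _ : Fin n => (volume : Measure ℝ))
    (φ := fun (i : Fin n) t => t ^ (i : ℕ) * w t) fun i _ => hint i i.2
  rw [unnormalizedLaw, withDensity_apply _ MeasurableSet.univ, Measure.restrict_univ]
  refine ne_of_lt (lt_of_eq_of_lt (lintegral_congr fun x => ?_) h.2)
  have hdet := Matrix.det_mul_column (fun j => w (x j)) (Matrix.vandermonde x)
  simp only [Matrix.vandermonde_apply, mul_comm (w _)] at hdet
  refine Eq.trans ?_ (congrArg enorm hdet).symm
  rw [unnormalizedDensity, pow_one, ← ofReal_norm, Real.norm_eq_abs, abs_mul,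
    abs_of_nonneg (Finset.prod_nonneg fun i _ => hw0 _)]

lemma unnormalizedLaw_univ_ne_zero {n β : ℕ} {w : ℝ → ℝ} (hw : Measurable w)
    (hpos : ∀ x ∈ Set.Ioo (0 : ℝ) 1, 0 < w x) :
    unnormalizedLaw n β w Set.univ ≠ 0 := by
  intro h
  rw [unnormalizedLaw, withDensity_apply _ MeasurableSet.univ, Measure.restrict_univ,
    lintegral_eq_zero_iff (measurable_unnormalizedDensity n β hw).ennreal_ofReal] at h
  have h1 : ∀ᵐ x : Fin n → ℝ, x ∉ Set.univ.pi fun _ : Fin n => Set.Ioo (0 : ℝ) 1 := by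
    filter_upwards [h, ae_injective n] with x hx hinj hmem
    have h2 : 0 < unnormalizedDensity n β w x :=
      mul_pos (Finset.prod_pos fun i _ => hpos _ (hmem i trivial))
        (pow_pos (abs_pos.2 (Matrix.det_vandermonde_ne_zero_iff.2 hinj)) β)
    exact absurd (ENNReal.ofReal_eq_zero.1 hx) (not_le.2 h2)
  have h2 := measure_eq_zero_iff_ae_notMem.2 h1
  rw [Real.volume_pi_Ioo] at h2
  simp at h2

/-! ### The classical weight pairs -/

lemma integrable_sub_mul_weight {n r : ℕ} {w : ℝ → ℝ}
    (hint : ∀ p < n, Integrable fun x => x ^ p * w x) (hr : r + 2 ≤ n) (b c : ℝ) :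
    Integrable fun x => (b * x ^ (r - 1) - c * x ^ (r + 1)) * w x :=
  (((hint (r - 1) (by omega)).const_mul b).sub
    ((hint (r + 1) (by omega)).const_mul c)).congr (Filter.Eventually.of_forall fun x => by
      simp only [Pi.sub_apply]
      ring)

/-- The recurrence is the integrated form of `hasDerivAt_pow_mul`, divided by `β - rδ`. The three
families are `δ = 0, β = 1` (Gauss), `δ = 1, β = n+a-1` (Cauchy) and `δ = -1, β = 2(a+1)` (Jacobi).
-/
lemma exists_recurrence {n r : ℕ} {w : ℝ → ℝ} (hint : ∀ p < n, Integrable fun x => x ^ p * w x)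
    (hr : r + 2 ≤ n) {δ β : ℝ} (hne : β - r * δ ≠ 0) {u : ℝ → ℝ}
    (hftc : ∀ t, 0 ≤ t →
      ∫ x in Set.Ioi t, (r * x ^ (r - 1) - (β - r * δ) * x ^ (r + 1)) * w x = -(t ^ r * u t)) :
    ∃ c d : ℝ, (r = 0 → d = 0) ∧ ∀ t, 0 ≤ t →
      ∫ x in Set.Ioi t, x ^ (r + 1) * w x =
        c * (t ^ r * u t) + d * ∫ x in Set.Ioi t, x ^ (r - 1) * w x := by
  refine ⟨(β - r * δ)⁻¹, r * (β - r * δ)⁻¹, fun h => by simp [h], fun t ht => ?_⟩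
  have h := hftc t ht
  have e : ∀ x, (r * x ^ (r - 1) - (β - r * δ) * x ^ (r + 1)) * w x =
      r * (x ^ (r - 1) * w x) - (β - r * δ) * (x ^ (r + 1) * w x) := fun x => by ring
  simp only [e] at h
  rw [integral_sub ((hint (r - 1) (by omega)).integrableOn.const_mul _)
    ((hint (r + 1) (by omega)).integrableOn.const_mul _), integral_const_mul,
    integral_const_mul] at h
  field_simp
  linarith

lemma hasDerivAt_pow_mul {r : ℕ} {δ β w t : ℝ} {u : ℝ → ℝ} (hu : u t = (1 + δ * t ^ 2) * w)
    (hd : HasDerivAt u (-(β * (t * w))) t) :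
    HasDerivAt (fun x => x ^ r * u x) ((r * t ^ (r - 1) - (β - r * δ) * t ^ (r + 1)) * w) t := by
  refine ((hasDerivAt_pow r t).fun_mul hd).congr_deriv ?_
  rw [hu]
  rcases r with _ | r
  · simp only [Nat.cast_zero]; ring
  · simp only [Nat.add_sub_cancel]; ring

lemma isDecimationPair_gauss (n : ℕ) :
    IsDecimationPair n (fun x => Real.exp (-x ^ 2 / 2)) (fun x => Real.exp (-x ^ 2))
      (fun x => Real.exp (-x ^ 2 / 2)) := by
  have hint : ∀ p : ℕ, Integrable fun x : ℝ => x ^ p * Real.exp (-x ^ 2 / 2) := by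
    intro p
    have h := integrable_rpow_mul_exp_neg_mul_sq (b := 1 / 2) (by norm_num) (s := p)
      (by have : (0 : ℝ) ≤ p := p.cast_nonneg
          linarith)
    refine h.congr (Filter.Eventually.of_forall fun x => ?_)
    simp only [Real.rpow_natCast]
    congr 2
    ring
  have hderiv : ∀ t : ℝ, HasDerivAt (fun x : ℝ => Real.exp (-x ^ 2 / 2))
      (-(1 * (t * Real.exp (-t ^ 2 / 2)))) t := by
    intro t
    refine (((hasDerivAt_pow 2 t).fun_neg).div_const 2).exp.congr_deriv ?_
    simp only [Nat.cast_ofNat, Nat.add_one_sub_one, pow_one]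
    ring
  refine ⟨by fun_prop, fun x => by simp, fun x => (Real.exp_pos _).le, fun x _ => Real.exp_pos _,
    fun p _ => hint p, fun x _ => (Real.exp_pos _).le, fun x _ => ?_, fun r hr => ?_⟩
  · rw [← Real.exp_add]; ring_nf
  · have hint' : Integrable fun x : ℝ =>
        (r * x ^ (r - 1) - (1 - r * 0) * x ^ (r + 1)) * Real.exp (-x ^ 2 / 2) :=
      integrable_sub_mul_weight (fun p _ => hint p) hr _ _
    have hd := fun t => hasDerivAt_pow_mul (r := r) (δ := 0) (by simp) (hderiv t)
    refine exists_recurrence (δ := 0) (β := 1) (fun p _ => hint p) hr (by norm_num) fun t _ => ?_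
    rw [integral_Ioi_of_hasDerivAt_of_tendsto (hd t).continuousAt.continuousWithinAt
      (fun x _ => hd x) hint'.integrableOn (tendsto_zero_of_hasDerivAt_of_integrableOn_Ioi (a := t)
        (fun x _ => hd x) hint'.integrableOn (hint r).integrableOn), zero_sub]

lemma isDecimationPair_cauchy (n : ℕ) {a : ℝ} (ha : -1 < a) :
    IsDecimationPair n (fun x => (1 + x ^ 2) ^ (-((n : ℝ) + a + 1) / 2))
      (fun x => (1 + x ^ 2) ^ (-((n : ℝ) + a))) (fun x => (1 + x ^ 2) ^ (-((n : ℝ) + a - 1) / 2))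
      := by
  have hpos : ∀ x : ℝ, 0 < 1 + x ^ 2 := fun x => by positivity
  have hbound : ∀ (p : ℕ) (q x : ℝ), |x ^ p * (1 + x ^ 2) ^ q| ≤ (1 + x ^ 2) ^ (q + p / 2) := by
    intro p q x
    rw [abs_mul, abs_of_pos (Real.rpow_pos_of_pos (hpos x) q), Real.rpow_add (hpos x), mul_comm,
      abs_pow]
    refine mul_le_mul_of_nonneg_left ?_ (Real.rpow_nonneg (hpos x).le _)
    have h1 : |x| ≤ √(1 + x ^ 2) := Real.abs_le_sqrt (by linarith)
    calc |x| ^ p ≤ √(1 + x ^ 2) ^ p := pow_le_pow_left₀ (abs_nonneg x) h1 p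
      _ = (1 + x ^ 2) ^ ((p : ℝ) / 2) := by
        rw [Real.sqrt_eq_rpow, ← Real.rpow_natCast, ← Real.rpow_mul (hpos x).le]
        ring_nf
  have hmeas : ∀ q : ℝ, Measurable fun x : ℝ => (1 + x ^ 2) ^ q := fun q => by fun_prop
  have hint : ∀ p < n, Integrable fun x : ℝ => x ^ p * (1 + x ^ 2) ^ (-((n : ℝ) + a + 1) / 2) := by
    intro p hp
    have hp' : (p : ℝ) + 1 ≤ n := by exact_mod_cast hp
    -- The decay exponent `n + a + 1 - p` exceeds `1` because `p ≤ n - 1` and `a > -1`.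
    have h := integrable_rpow_neg_one_add_norm_sq (E := ℝ) (μ := volume)
      (r := (n : ℝ) + a + 1 - p) (by simp; linarith)
    refine h.mono' (by have := hmeas; fun_prop) (Filter.Eventually.of_forall fun x => ?_)
    rw [Real.norm_eq_abs, Real.norm_eq_abs, sq_abs]
    refine (hbound p _ x).trans (le_of_eq ?_)
    congr 1
    ring
  have hderiv : ∀ t : ℝ, HasDerivAt (fun x : ℝ => (1 + x ^ 2) ^ (-((n : ℝ) + a - 1) / 2))
      (-(((n : ℝ) + a - 1) * (t * (1 + t ^ 2) ^ (-((n : ℝ) + a + 1) / 2)))) t := by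
    intro t
    convert (((hasDerivAt_pow 2 t).const_add 1).rpow_const (p := -((n : ℝ) + a - 1) / 2)
      (Or.inl (hpos t).ne')) using 1
    have : -((n : ℝ) + a - 1) / 2 - 1 = -((n : ℝ) + a + 1) / 2 := by ring
    rw [this]
    simp
    ring
  have hu : ∀ t : ℝ, (1 + t ^ 2) ^ (-((n : ℝ) + a - 1) / 2) =
      (1 + 1 * t ^ 2) * (1 + t ^ 2) ^ (-((n : ℝ) + a + 1) / 2) := by
    intro t
    have : -((n : ℝ) + a - 1) / 2 = 1 + -((n : ℝ) + a + 1) / 2 := by ring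
    rw [this, Real.rpow_add (hpos t), Real.rpow_one, one_mul]
  refine ⟨hmeas _, fun x => by simp, fun x => Real.rpow_nonneg (hpos x).le _,
    fun x _ => Real.rpow_pos_of_pos (hpos x) _,
    hint, fun x _ => Real.rpow_nonneg (hpos x).le _, fun x _ => ?_, fun r hr => ?_⟩
  · rw [← Real.rpow_add (hpos x)]; ring_nf
  · have hr' : (r : ℝ) + 2 ≤ n := by exact_mod_cast hr
    have hint' : Integrable fun x : ℝ =>
        (r * x ^ (r - 1) - (((n : ℝ) + a - 1) - r * 1) * x ^ (r + 1)) *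
          (1 + x ^ 2) ^ (-((n : ℝ) + a + 1) / 2) :=
      integrable_sub_mul_weight hint hr _ _
    have hd := fun t => hasDerivAt_pow_mul (r := r) (δ := 1) (hu t) (hderiv t)
    have hlim : Filter.Tendsto (fun x : ℝ => x ^ r * (1 + x ^ 2) ^ (-((n : ℝ) + a - 1) / 2))
        Filter.atTop (nhds 0) := by
      have h1 : Filter.Tendsto (fun x : ℝ => (1 + x ^ 2) ^ (-(((n : ℝ) + a - 1 - r) / 2)))
          Filter.atTop (nhds 0) :=
        (tendsto_rpow_neg_atTop (by linarith)).comp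
          (Filter.tendsto_atTop_add_const_left _ _ (Filter.tendsto_pow_atTop two_ne_zero))
      refine squeeze_zero_norm (fun x => ?_) h1
      rw [Real.norm_eq_abs]
      refine (hbound r _ x).trans (le_of_eq ?_)
      congr 1
      ring
    refine exists_recurrence (δ := 1) (β := (n : ℝ) + a - 1) hint hr
      (by intro h; linarith) fun t _ => ?_
    rw [integral_Ioi_of_hasDerivAt_of_tendsto (hd t).continuousAt.continuousWithinAt
      (fun x _ => hd x) hint'.integrableOn hlim, zero_sub]

lemma integrableOn_one_sub_sq_rpow {a : ℝ} (ha : -1 < a) :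
    IntegrableOn (fun x : ℝ => (1 - x ^ 2) ^ a) (Set.Ioo (-1) 1) := by
  have h1 : IntervalIntegrable (fun x : ℝ => (1 - x) ^ a) volume (-1) 1 := by
    have := (intervalIntegral.intervalIntegrable_rpow' (a := 2) (b := 0) ha).comp_sub_left 1
    norm_num at this
    exact this
  have h2 : IntervalIntegrable (fun x : ℝ => (1 + x) ^ a) volume (-1) 1 := by
    have := (intervalIntegral.intervalIntegrable_rpow' (a := 0) (b := 2) ha).comp_add_left 1
    norm_num at this
    exact this
  have h3 : IntegrableOn (fun x : ℝ => (1 + 2 ^ a) * ((1 - x) ^ a + (1 + x) ^ a))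
      (Set.Ioo (-1) 1) :=
    (((intervalIntegrable_iff_integrableOn_Ioo_of_le (by norm_num)).1 h1).add
      ((intervalIntegrable_iff_integrableOn_Ioo_of_le (by norm_num)).1 h2)).const_mul _
  -- In `(1+x)^a (1-x)^a` the factor with base in `[1, 2]` is bounded by `1 + 2^a` whatever the sign
  -- of `a`; the other is integrable.
  have hle : ∀ y : ℝ, 1 ≤ y → y ≤ 2 → y ^ a ≤ 1 + 2 ^ a := by
    intro y hy hy2
    have h2a : (0 : ℝ) < 2 ^ a := Real.rpow_pos_of_pos two_pos a
    rcases le_total 0 a with h | h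
    · linarith [Real.rpow_le_rpow (by linarith) hy2 h]
    · linarith [Real.rpow_le_one_of_one_le_of_nonpos hy h]
  refine h3.mono' (Measurable.aestronglyMeasurable (by fun_prop))
    ((ae_restrict_mem measurableSet_Ioo).mono fun x hx => ?_)
  have hp : 0 ≤ 1 + x := by linarith [hx.1]
  have hm : 0 ≤ 1 - x := by linarith [hx.2]
  have e : 1 - x ^ 2 = (1 + x) * (1 - x) := by ring
  have hpa := Real.rpow_nonneg hp a
  have hma := Real.rpow_nonneg hm a
  rw [e, Real.mul_rpow hp hm, Real.norm_eq_abs, abs_of_nonneg (mul_nonneg hpa hma)]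
  have h2a : (0 : ℝ) < 2 ^ a := Real.rpow_pos_of_pos two_pos a
  rcases le_total 0 x with h | h
  · nlinarith [mul_le_mul_of_nonneg_right (hle (1 + x) (by linarith) (by linarith [hx.2])) hma]
  · nlinarith [mul_le_mul_of_nonneg_right (hle (1 - x) (by linarith) (by linarith [hx.1])) hpa]

lemma isDecimationPair_jacobi (n : ℕ) {a : ℝ} (ha : -1 < a) :
    IsDecimationPair n ((Set.Ioo (-1) 1).indicator fun x => (1 - x ^ 2) ^ a)
      ((Set.Ioo (-1) 1).indicator fun x => (1 - x ^ 2) ^ (2 * a + 1))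
      ((Set.Ioo (-1) 1).indicator fun x => (1 - x ^ 2) ^ (a + 1)) := by
  have hpos : ∀ x ∈ Set.Ioo (-1 : ℝ) 1, 0 < 1 - x ^ 2 := fun x hx => by nlinarith [hx.1, hx.2]
  have hint : ∀ p : ℕ, Integrable fun x : ℝ =>
      x ^ p * (Set.Ioo (-1) 1).indicator (fun x => (1 - x ^ 2) ^ a) x := by
    intro p
    have h := (integrable_indicator_iff measurableSet_Ioo).2 (integrableOn_one_sub_sq_rpow ha)
    refine h.mono' ?_ (Filter.Eventually.of_forall fun x => ?_)
    · exact (by fun_prop : Measurable fun x : ℝ => x ^ p).aestronglyMeasurable.mul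
        h.aestronglyMeasurable
    · by_cases hx : x ∈ Set.Ioo (-1 : ℝ) 1
      · rw [Set.indicator_of_mem hx, norm_mul, Real.norm_eq_abs, Real.norm_eq_abs, abs_pow,
          abs_of_pos (Real.rpow_pos_of_pos (hpos x hx) _)]
        exact mul_le_of_le_one_left (Real.rpow_nonneg (hpos x hx).le _)
          (pow_le_one₀ (abs_nonneg x) (abs_le.2 ⟨hx.1.le, hx.2.le⟩))
      · simp [Set.indicator_of_notMem hx]
  refine ⟨Measurable.indicator (by fun_prop) measurableSet_Ioo, fun x => ?_,
    Set.indicator_nonneg fun x hx => Real.rpow_nonneg (hpos x hx).le _, fun x hx => ?_,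
    fun p _ => hint p,
    fun x _ => Set.indicator_nonneg (fun x hx => Real.rpow_nonneg (hpos x hx).le _) x,
    fun x _ => ?_, fun r hr => ?_⟩
  · have : -x ∈ Set.Ioo (-1 : ℝ) 1 ↔ x ∈ Set.Ioo (-1 : ℝ) 1 := by
      constructor <;> rintro ⟨h1, h2⟩ <;> constructor <;> linarith
    by_cases hx : x ∈ Set.Ioo (-1 : ℝ) 1
    · rw [Set.indicator_of_mem hx, Set.indicator_of_mem (this.2 hx), neg_sq]
    · rw [Set.indicator_of_notMem hx, Set.indicator_of_notMem (mt this.1 hx)]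
  · have hx' : x ∈ Set.Ioo (-1 : ℝ) 1 := ⟨by linarith [hx.1], hx.2⟩
    rw [Set.indicator_of_mem hx']
    exact Real.rpow_pos_of_pos (hpos x hx') _
  · by_cases hx : x ∈ Set.Ioo (-1 : ℝ) 1
    · simp only [Set.indicator_of_mem hx]
      rw [← Real.rpow_add (hpos x hx)]
      ring_nf
    · simp [Set.indicator_of_notMem hx]
  · have hr0 : (0 : ℝ) ≤ r := r.cast_nonneg
    refine exists_recurrence (δ := -1) (β := 2 * (a + 1)) (fun p _ => hint p) hr
      (by intro h; linarith) fun t ht => ?_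
    set g : ℝ → ℝ := fun x => (r * x ^ (r - 1) - (2 * (a + 1) - r * -1) * x ^ (r + 1)) *
          (Set.Ioo (-1) 1).indicator (fun x => (1 - x ^ 2) ^ a) x with hg
    have hint' : Integrable g := integrable_sub_mul_weight (fun p _ => hint p) hr _ _
    have hzero : ∀ x ∈ Set.Ioi (1 : ℝ), g x = 0 := fun x hx => by
      have : x ∉ Set.Ioo (-1 : ℝ) 1 := fun h => absurd h.2 (not_lt.2 (le_of_lt hx))
      simp [hg, Set.indicator_of_notMem this]
    -- For `t ≥ 1` both sides vanish. For `t < 1` the boundary term at `1` vanishes as `a + 1 > 0`;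
    -- differentiability is needed only inside the interval, continuity up to its end.
    rcases lt_or_ge t 1 with h1 | h1
    · have htI : t ∈ Set.Ioo (-1 : ℝ) 1 := ⟨by linarith, h1⟩
      rw [← Set.Ioc_union_Ioi_eq_Ioi h1.le, setIntegral_union (Set.Ioc_disjoint_Ioi le_rfl)
        measurableSet_Ioi hint'.integrableOn hint'.integrableOn,
        setIntegral_eq_zero_of_forall_eq_zero hzero, add_zero,
        ← intervalIntegral.integral_of_le h1.le,
        intervalIntegral.integral_eq_sub_of_hasDerivAt_of_le (f := fun x => x ^ r *
          (1 - x ^ 2) ^ (a + 1)) h1.le]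
      · rw [Set.indicator_of_mem htI]
        simp [Real.zero_rpow (by linarith : a + 1 ≠ 0)]
      · refine Continuous.continuousOn ?_
        exact (continuous_pow r).mul
          ((continuous_const.sub (continuous_pow 2)).rpow_const fun x => Or.inr (by linarith))
      · intro x hx
        have hxI : x ∈ Set.Ioo (-1 : ℝ) 1 := ⟨by linarith [hx.1], hx.2⟩
        simp only [hg, Set.indicator_of_mem hxI]
        refine hasDerivAt_pow_mul (u := fun x => (1 - x ^ 2) ^ (a + 1)) ?_ ?_
        · rw [Real.rpow_add (hpos x hxI), Real.rpow_one]; ring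
        · refine (((hasDerivAt_pow 2 x).const_sub 1).rpow_const (p := a + 1)
            (Or.inl (hpos x hxI).ne')).congr_deriv ?_
          simp only [Nat.cast_ofNat, Nat.add_one_sub_one, pow_one, add_sub_cancel_right]
          ring
      · exact hint'.intervalIntegrable
    · have htI : t ∉ Set.Ioo (-1 : ℝ) 1 := fun h => absurd h.2 (not_lt.2 h1)
      rw [Set.indicator_of_notMem htI, mul_zero, neg_zero]
      exact setIntegral_eq_zero_of_forall_eq_zero fun x hx =>
        hzero x (h1.trans_lt (Set.mem_Ioi.1 hx))

lemma IsWeightPair.exists_isDecimationPair {n : ℕ} {w₁ w₂ : ℝ → ℝ} (hw : IsWeightPair n w₁ w₂) :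
    ∃ u, IsDecimationPair n w₁ w₂ u := by
  cases hw with
  | gauss => exact ⟨_, isDecimationPair_gauss n⟩
  | jacobi a ha => exact ⟨_, isDecimationPair_jacobi n ha⟩
  | cauchy a ha => exact ⟨_, isDecimationPair_cauchy n ha⟩

/-! ### Decimation of the ensembles -/

lemma isProbabilityMeasure_ensemble {n β : ℕ} {w : ℝ → ℝ}
    (h0 : unnormalizedLaw n β w Set.univ ≠ 0) (h1 : unnormalizedLaw n β w Set.univ ≠ ⊤) :
    IsProbabilityMeasure (ensemble n β w) :=
  ⟨by rw [ensemble, Measure.smul_apply, smul_eq_mul, ENNReal.inv_mul_cancel h0 h1]⟩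

lemma ensemble_eq_div {n β : ℕ} {w : ℝ → ℝ} {A : Set (Fin n → ℝ)} {c T I : ℝ≥0∞} (hc0 : c ≠ 0)
    (hc : c ≠ ⊤) (hT : unnormalizedLaw n β w Set.univ = c * T)
    (hI : unnormalizedLaw n β w A = c * I) : ensemble n β w A = I / T := by
  rw [ensemble, Measure.smul_apply, smul_eq_mul, hT, hI, mul_comm, ← div_eq_mul_inv,
    ENNReal.mul_div_mul_left _ _ hc0 hc]

lemma ncard_comp_perm {n : ℕ} (σ : Equiv.Perm (Fin n)) (x : Fin n → ℝ) (J : Set ℝ) :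
    ({i | (x ∘ σ) i ∈ J} : Set (Fin n)).ncard = ({i | x i ∈ J} : Set (Fin n)).ncard := by
  have : ({i | (x ∘ σ) i ∈ J} : Set (Fin n)) = σ ⁻¹' {i | x i ∈ J} := rfl
  rw [this, Set.ncard_preimage_of_injective_subset_range σ.injective
    (by rw [σ.range_eq_univ]; exact Set.subset_univ _)]

lemma setOf_signFlip_mem_Ioo {n : ℕ} (ε : Fin n → ℤˣ) (x : Fin n → ℝ) (s : ℝ) :
    ({i | ((ε i : ℤ) : ℝ) * x i ∈ Set.Ioo (-s) s} : Set (Fin n)) =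
      {i | x i ∈ Set.Ioo (-s) s} := by
  ext i
  simp only [Set.mem_ofPred_eq, ← abs_lt, Set.mem_Ioo]
  rcases Int.units_eq_one_or (ε i) with h | h <;> simp [h]

lemma IsDecimationPair.gapProb_add {n m μ : ℕ} (hμ : μ = 0 ∨ μ = 1) (hn : n = 2 * m + μ)
    {w₁ w₂ u : ℝ → ℝ} (hw : IsDecimationPair n w₁ w₂ u) :
    IsProbabilityMeasure (ensemble n 1 w₁) ∧
    IsProbabilityMeasure (ensemble m 2 (squaredWeight μ w₂)) ∧
    ∀ (k : ℕ) (s : ℝ), 0 ≤ s →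
      gapProb n 1 (2 * (k : ℤ) + (μ : ℤ) - 1) (Set.Ioo (-s) s) w₁ +
          gapProb n 1 (2 * (k : ℤ) + (μ : ℤ)) (Set.Ioo (-s) s) w₁ =
        gapProb m 2 (k : ℤ) (Set.Ioo 0 (s ^ 2)) (squaredWeight μ w₂) := by
  obtain ⟨c, hc, hlaw⟩ := exists_unnormalizedLaw_one_eq hμ hn hw
  have hT₁ := hlaw Set.univ Set.univ MeasurableSet.univ (by simp) (by simp) (by simp)
  have hT₂ := unnormalizedLaw_squaredWeight_eq (μ := μ) w₂ (B := (Set.univ : Set (Fin m → ℝ)))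
    MeasurableSet.univ (by simp)
  have h0 := unnormalizedLaw_univ_ne_zero (n := n) (β := 1) hw.measurable hw.pos
  have h1 := unnormalizedLaw_one_univ_ne_top hw.integrable hw.nonneg
  -- The orthogonal mass is positive and finite and equals `c` times the decimated mass, so both
  -- factors are nonzero and the latter is finite. Normalizability of the unitary ensemble follows.
  have hc0 : c ≠ 0 := fun h => h0 (by rw [hT₁, h, zero_mul])
  have hI0 : decimatedMass m μ w₂ Set.univ ≠ 0 := fun h => h0 (by rw [hT₁, h, mul_zero])
  have hI1 : decimatedMass m μ w₂ Set.univ ≠ ⊤ := fun h => h1 (by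
    rw [hT₁, h, ENNReal.mul_top hc0])
  have hd0 : ((m.factorial : ℝ≥0∞) * 2 ^ m) ≠ 0 := by
    simp [Nat.factorial_ne_zero]
  have hd1 : ((m.factorial : ℝ≥0∞) * 2 ^ m) ≠ ⊤ :=
    ENNReal.mul_ne_top (by simp) (ENNReal.pow_ne_top (by simp))
  have hp₁ := isProbabilityMeasure_ensemble h0 h1
  refine ⟨hp₁, isProbabilityMeasure_ensemble (by rw [hT₂]; exact mul_ne_zero hd0 hI0)
    (by rw [hT₂]; exact ENNReal.mul_ne_top hd1 hI1), fun k s hs => ?_⟩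
  have hmeas : ∀ j : ℤ, MeasurableSet
      {x : Fin n → ℝ | (({i | x i ∈ Set.Ioo (-s) s} : Set (Fin n)).ncard : ℤ) = j} :=
    fun j => measurableSet_ncard_eq n j measurableSet_Ioo
  rw [gapProb, gapProb, gapProb, ← measureReal_union _ (hmeas _)]
  · rw [Measure.real, Measure.real]
    congr 1
    refine Eq.trans (ensemble_eq_div hc0 hc hT₁ (hlaw _
      {x | (({i | x i ∈ Set.Ioo 0 (s ^ 2)} : Set (Fin m)).ncard : ℤ) = k}
      ((hmeas _).union (hmeas _)) ?_ ?_ ?_)) (ensemble_eq_div hd0 hd1 hT₂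
      (unnormalizedLaw_squaredWeight_eq w₂ (measurableSet_ncard_eq m k measurableSet_Ioo) ?_)).symm
    · intro σ x
      simp only [Set.mem_union, Set.mem_ofPred_eq, ncard_comp_perm]
    · intro ε x
      simp only [Set.mem_union, Set.mem_ofPred_eq, setOf_signFlip_mem_Ioo]
    · intro x hx
      have e₁ : ({i | x i ∈ Set.Ioo (-s) s} : Set (Fin n)) = {i | x i < s} := by
        ext i
        have := hx.1 i
        simp only [Set.mem_ofPred_eq, Set.mem_Ioo]
        exact ⟨fun h => h.2, fun h => ⟨by linarith, h⟩⟩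
      have e₂ : ({i | x (interlace hμ hn (Sum.inl i)) ^ 2 ∈ Set.Ioo 0 (s ^ 2)} : Set (Fin m)) =
          {i | x (interlace hμ hn (Sum.inl i)) < s} := by
        ext i
        have := hx.1 (interlace hμ hn (Sum.inl i))
        simp only [Set.mem_ofPred_eq, Set.mem_Ioo]
        rw [pow_lt_pow_iff_left₀ this.le hs two_ne_zero]
        exact ⟨fun h => h.2, fun h => ⟨by positivity, h⟩⟩
      simp only [Set.mem_union, Set.mem_ofPred_eq]
      rw [e₁, e₂]
      exact ncard_decimate hμ hn hx.2 s k
    · intro σ x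
      simp only [Set.mem_ofPred_eq, ncard_comp_perm]
  · refine Set.disjoint_left.2 fun x hx hx' => ?_
    simp only [Set.mem_ofPred_eq] at hx hx'
    omega

end GapProbability

theorem theorem4 (n m μ : ℕ) (hμ : μ = 0 ∨ μ = 1) (hn : n = 2 * m + μ)
    (w₁ w₂ : ℝ → ℝ) (hw : GapProbability.IsWeightPair n w₁ w₂) :
    MeasureTheory.IsProbabilityMeasure (GapProbability.ensemble n 1 w₁) ∧
    MeasureTheory.IsProbabilityMeasure
      (GapProbability.ensemble m 2 (GapProbability.squaredWeight μ w₂)) ∧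
    ∀ (k : ℕ) (s : ℝ), 0 ≤ s →
      GapProbability.gapProb n 1 (2 * (k : ℤ) + (μ : ℤ) - 1) (Set.Ioo (-s) s) w₁ +
          GapProbability.gapProb n 1 (2 * (k : ℤ) + (μ : ℤ)) (Set.Ioo (-s) s) w₁ =
        GapProbability.gapProb m 2 (k : ℤ) (Set.Ioo 0 (s ^ 2))
          (GapProbability.squaredWeight μ w₂) := by
  obtain ⟨u, hu⟩ := hw.exists_isDecimationPair
  exact hu.gapProb_add hμ hn
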